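/- For integers $n\ge 2$ and $0\le m\le\binom n2$, let $\vec G(n,m)$ be the random directed graph on $n$ labelled vertices obtained by choosing a graph uniformly at random among all simple graphs on these vertices with exactly $m$ edges and then giving each of its edges one of its two directions with probability $1/2$ each, independently. Write $u\not\to v$ for the event that $\vec G(n,m)$ contains no directed path from $u$ to $v$, let $\mathbb P$ be the joint law of the graph and the orientation, and put $\operatorname{Cov}(A,B)=\mathbb P(A\cap B)-\mathbb P(A)\mathbb P(B)$ for events $A,B$. Suppose that $m=m(n)\to\infty$ as $n\to\infty$, let $p=p(n)=m/\binom n2$, and assume $\liminf_{n\to\infty} p(n)>0$. Then, as $n\to\infty$, for any distinct vertices $s,a,b$ of $\vec G(n,m)$, $$\operatorname{Cov}(s\not\to a,\;b\not\to s)=\left(\frac{3}{4-2p}\,e^{-\frac{2p(1-p)}{(2-p)^2}}-1+o(1)\right)\mathbb P(s\not\to a)^2$$ and $$\operatorname{Cov}(s\not\to a,\;b\not\to s)=\left(3e^{-\frac{2p(1-p)}{(2-p)^2}}-4+2p+o(1)\right)\left(1-\frac p2\right)^{2n-3}e^{-\frac{2p(1-p)}{(2-p)^2}},$$ where each $o(1)$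 denotes a quantity that depends only on $n$ (and the sequence $m(n)$), not on the choice of $s,a,b$, and tends to $0$. -/

import Mathlib

open Filter Topology MeasureTheory ProbabilityTheory

noncomputable section

/-- The uniform random graph `G(n,m)`: the uniform distribution on the simple graphs with
vertex set `Fin n` and exactly `m` edges. -/
def gnm (n m : ℕ) : Measure (SimpleGraph (Fin n)) :=
  uniformOn {G : SimpleGraph (Fin n) | G.edgeSet.ncard = m}

/-- Independent fair coins, one for each unordered pair of vertices
(the uniform distribution on all families of coin tosses). -/
def fairCoins (n : ℕ) : Measure (Sym2 (Fin n) → Bool) :=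
  uniformOn Set.univ

/-- The joint (annealed) law of `G(n,m)` and of the independent coins that orient its edges. -/
def orientedGnm (n m : ℕ) : Measure (SimpleGraph (Fin n) × (Sym2 (Fin n) → Bool)) :=
  (gnm n m).prod (fairCoins n)

/-- The graph `ω.1`, with each edge `{u, v}`, `u < v`, directed from `u` to `v` if its coin shows
`true` and from `v` to `u` if it shows `false`. Coins of non-edges are not used. -/
def orientedGraph {n : ℕ} (ω : SimpleGraph (Fin n) × (Sym2 (Fin n) → Bool)) : Digraph (Fin n) where
  Adj u v := ω.1.Adj u v ∧ (ω.2 s(u, v) = true ↔ u < v)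

/-- The event that there is no directed path from `u` to `v`. -/
def notReach {n : ℕ} (u v : Fin n) : Set (SimpleGraph (Fin n) × (Sym2 (Fin n) → Bool)) :=
  {ω | ¬ Relation.ReflTransGen (orientedGraph ω).Adj u v}

/-- The covariance `P(A ∩ B) - P(A) P(B)` of two events. -/
def eventCov {Ω : Type*} [MeasurableSpace Ω] (P : Measure Ω) (A B : Set Ω) : ℝ :=
  P.real (A ∩ B) - P.real A * P.real B

/-- The edge density `m / (n choose 2)`. -/
def edgeDensity (n m : ℕ) : ℝ := (m : ℝ) / (n.choose 2 : ℝ)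

end

/-! If `s` does not reach `a`, the vertices reachable from `s` form a set that contains `s`, misses
`a` and has no outgoing arc. Such a closed set with k vertices forbids k(n-k) arcs, so closed sets
that are neither tiny nor nearly everything are negligible. In essence, then, either `s` has no
out-arc or `a` has no in-arc, and each of these forbids n-1 arcs. For both failures together three
scenarios remain: `b` has no out-arc and `s` none except to `b`; `a` has no in-arc and `b` no
out-arc; `a` has no in-arc and `s` none except from `a` (`not_reach_cases`). Each forbids arcs on
2n-3 distinct pairs, the pair joining the two centres being counted once.

Let f(K) be the probability that prescribed arcs on K distinct pairs are absent; it is the mean of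
2^(-|E ∩ T|) over the edge sets E, where |T| = K (`slotProb`). Double counting links f(K-1), f(K)
and f(K+1) (`slotProb_recurrence`). Chebyshev's sum inequality yields f(K+1)/f(K) ≤ 1-p/2, and
feeding bounds back into the recurrence twice yields f(K) = (1-p/2)^K exp(-g K(K-1)/(2N) +
O(K^3/N^2)), where N = C(n,2) and g = p(1-p)/(2-p)^2 (`slotProb_bounds`). For K = n-1 and K = 2n-3
the exponential is e^(-g) and e^(-4g) up to a factor 1+O(1/n).

Hence P(s↛a) ~ 2(1-p/2)^(n-1) e^(-g), and the joint probability is ~ 3(1-p/2)^(2n-3) e^(-4g). The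
exponent in the theorem is 2g, so both formulas follow by algebra. The error events are
exponentially smaller because p stays away from 0 (`real_error_le`). -/

/-! ### The mean of 2^(-|E ∩ T|) over m-element sets E: recurrence and ratio bound. -/

/-- The sum of `2 ^ (-|E ∩ T|)` over the `m`-element subsets `E` of `U`. -/
noncomputable def slotWeight {ι : Type*} [DecidableEq ι] (U T : Finset ι) (m : ℕ) : ℝ :=
  ∑ E ∈ U.powersetCard m, (1 / 2 : ℝ) ^ (E ∩ T).card

lemma slotWeight_insert {ι : Type*} [DecidableEq ι] {U T : Finset ι} {e : ι} (hU : e ∉ U)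
    (m : ℕ) :
    slotWeight (insert e U) (insert e T) (m + 1) =
      slotWeight U T (m + 1) + 1 / 2 * slotWeight U T m := by
  unfold slotWeight
  rw [Finset.powersetCard_succ_insert hU, Finset.sum_union, Finset.sum_image]
  · congr 1
    · refine Finset.sum_congr rfl fun E hE => ?_
      have : e ∉ E := fun h => hU ((Finset.mem_powersetCard.1 hE).1 h)
      rw [Finset.inter_insert_of_notMem this]
    · rw [Finset.mul_sum]
      refine Finset.sum_congr rfl fun E hE => ?_
      have : e ∉ E := fun h => hU ((Finset.mem_powersetCard.1 hE).1 h)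
      rw [← Finset.insert_inter_distrib, Finset.card_insert_of_notMem (by simp [this]), pow_succ]
      ring
  · intro A hA B hB h
    have hA' : e ∉ A := fun h => hU ((Finset.mem_powersetCard.1 hA).1 h)
    have hB' : e ∉ B := fun h => hU ((Finset.mem_powersetCard.1 hB).1 h)
    rw [← Finset.erase_insert hA', ← Finset.erase_insert hB', h]
  · rw [Finset.disjoint_left]
    intro A hA hA'
    obtain ⟨B, -, rfl⟩ := Finset.mem_image.1 hA'
    exact hU ((Finset.mem_powersetCard.1 hA).1 (Finset.mem_insert_self _ _))

/-- Deleting one element from both sets at a time reduces to empty `T`, where only |U| and m matter.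
-/
lemma slotWeight_congr {ι κ : Type*} [DecidableEq ι] [DecidableEq κ] (K : ℕ) :
    ∀ (m : ℕ) (U T : Finset ι) (U' T' : Finset κ), T ⊆ U → T' ⊆ U' → T.card = K → T'.card = K →
      U.card = U'.card → slotWeight U T m = slotWeight U' T' m := by
  induction K with
  | zero =>
    intro m U T U' T' _ _ hT hT' hU
    simp [slotWeight, Finset.card_eq_zero.1 hT, Finset.card_eq_zero.1 hT', hU]
  | succ K ih =>
    intro m U T U' T' hTU hTU' hT hT' hU
    cases m with
    | zero => simp [slotWeight]
    | succ m =>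
      obtain ⟨e, he⟩ : T.Nonempty := Finset.card_pos.1 (by omega)
      obtain ⟨e', he'⟩ : T'.Nonempty := Finset.card_pos.1 (by omega)
      have h1 := slotWeight_insert (T := T.erase e) (Finset.notMem_erase e U) m
      have h2 := slotWeight_insert (T := T'.erase e') (Finset.notMem_erase e' U') m
      rw [Finset.insert_erase (hTU he), Finset.insert_erase he] at h1
      rw [Finset.insert_erase (hTU' he'), Finset.insert_erase he'] at h2
      have hs := Finset.erase_subset_erase e hTU
      have hs' := Finset.erase_subset_erase e' hTU'
      have c1 := Finset.card_erase_of_mem he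
      have c2 := Finset.card_erase_of_mem he'
      have c3 := Finset.card_erase_of_mem (hTU he)
      have c4 := Finset.card_erase_of_mem (hTU' he')
      rw [h1, h2, ih (m + 1) _ _ _ _ hs hs' (by omega) (by omega) (by omega),
        ih m _ _ _ _ hs hs' (by omega) (by omega) (by omega)]

/-- Deleting an element of `E ∩ T` from `T` doubles the weight of `E`, and deleting any other
element of `T` leaves it unchanged. So each difference is the weight carried by the sets `E`
containing `e`. -/
lemma sum_mem_mul_slotWeight {ι : Type*} [DecidableEq ι] {U T : Finset ι} (m : ℕ) :
    ∑ E ∈ U.powersetCard m, ((E ∩ T).card : ℝ) * (1 / 2 : ℝ) ^ (E ∩ T).card =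
      ∑ e ∈ T, (slotWeight U (T.erase e) m - slotWeight U T m) := by
  unfold slotWeight
  simp_rw [← Finset.sum_sub_distrib]
  rw [Finset.sum_comm]
  refine Finset.sum_congr rfl fun E _ => ?_
  have : ∀ e ∈ T, (1 / 2 : ℝ) ^ (E ∩ T.erase e).card - (1 / 2 : ℝ) ^ (E ∩ T).card =
      if e ∈ E then (1 / 2 : ℝ) ^ (E ∩ T).card else 0 := by
    intro e he
    rw [Finset.inter_erase]
    split_ifs with h
    · have h1 : (E ∩ T).card = ((E ∩ T).erase e).card + 1 := by
        rw [Finset.card_erase_add_one (Finset.mem_inter.2 ⟨h, he⟩)]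
      rw [h1, pow_succ]
      ring
    · rw [Finset.erase_eq_of_notMem (by simp [h]), sub_self]
  rw [Finset.sum_congr rfl this, ← Finset.sum_filter, Finset.sum_const, nsmul_eq_mul,
    Finset.filter_mem_eq_inter, Finset.inter_comm]

/-- Adding an element of `E \ T` to `T` halves the weight of `E`, whence the factor 2. -/
lemma sum_notMem_mul_slotWeight {ι : Type*} [DecidableEq ι] {U T : Finset ι} (m : ℕ) :
    ∑ E ∈ U.powersetCard m, ((E \ T).card : ℝ) * (1 / 2 : ℝ) ^ (E ∩ T).card =
      ∑ e ∈ U \ T, 2 * (slotWeight U T m - slotWeight U (insert e T) m) := by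
  unfold slotWeight
  simp_rw [← Finset.sum_sub_distrib, Finset.mul_sum]
  rw [Finset.sum_comm]
  refine Finset.sum_congr rfl fun E hE => ?_
  have hEU := (Finset.mem_powersetCard.1 hE).1
  have : ∀ e ∈ U \ T, 2 * ((1 / 2 : ℝ) ^ (E ∩ T).card - (1 / 2 : ℝ) ^ (E ∩ insert e T).card) =
      if e ∈ E then (1 / 2 : ℝ) ^ (E ∩ T).card else 0 := by
    intro e he
    split_ifs with h
    · rw [Finset.inter_insert_of_mem h, Finset.card_insert_of_notMem
        (by simp [(Finset.mem_sdiff.1 he).2]), pow_succ]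
      ring
    · rw [Finset.inter_insert_of_notMem h, sub_self, mul_zero]
  rw [Finset.sum_congr rfl this, ← Finset.sum_filter, Finset.sum_const, nsmul_eq_mul,
    Finset.filter_mem_eq_inter]
  congr 3
  ext x
  simp only [Finset.mem_sdiff, Finset.mem_inter]
  exact ⟨fun h => ⟨⟨hEU h.1, h.2⟩, h.1⟩, fun h => ⟨h.2, h.1.2⟩⟩

/-- The probability that all present edges in a set of `K` of the `N` slots have prescribed
orientations, when `m` of the slots are occupied. -/
noncomputable def slotProb (N m K : ℕ) : ℝ :=
  slotWeight (Finset.range N) (Finset.range K) m / N.choose m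

lemma slotWeight_eq {ι : Type*} [DecidableEq ι] {U T : Finset ι} (hT : T ⊆ U) {m : ℕ}
    (hm : m ≤ U.card) :
    slotWeight U T m = slotProb U.card m T.card * U.card.choose m := by
  have : (0 : ℝ) < U.card.choose m := by exact_mod_cast Nat.choose_pos hm
  rw [slotProb, div_mul_cancel₀ _ this.ne']
  refine slotWeight_congr T.card m _ _ _ _ hT ?_ rfl (by simp) (by simp)
  exact Finset.range_subset_range.2 (Finset.card_le_card hT)

lemma slotProb_zero {N m : ℕ} (hm : m ≤ N) : slotProb N m 0 = 1 := by
  have : (0 : ℝ) < N.choose m := by exact_mod_cast Nat.choose_pos hm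
  simp [slotProb, slotWeight, this.ne']

lemma slotProb_pos {N m : ℕ} (hm : m ≤ N) (K : ℕ) : 0 < slotProb N m K := by
  have : (0 : ℝ) < N.choose m := by exact_mod_cast Nat.choose_pos hm
  refine div_pos (Finset.sum_pos (fun _ _ => by positivity) ?_) this
  rw [Finset.powersetCard_nonempty]
  simpa using hm

lemma slotProb_sum_erase {N m K : ℕ} (hm : m ≤ N) (hK : K ≤ N) :
    ∑ e ∈ Finset.range K, (slotWeight (Finset.range N) ((Finset.range K).erase e) m -
      slotWeight (Finset.range N) (Finset.range K) m) =
    K * (slotProb N m (K - 1) - slotProb N m K) * N.choose m := by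
  have hsub : Finset.range K ⊆ Finset.range N := Finset.range_subset_range.2 hK
  rw [Finset.sum_congr rfl (g := fun _ => (slotProb N m (K - 1) - slotProb N m K) * N.choose m)]
  · simp; ring
  · intro e he
    rw [slotWeight_eq ((Finset.erase_subset _ _).trans hsub) (by simpa using hm),
      slotWeight_eq hsub (by simpa using hm), Finset.card_erase_of_mem he]
    simp only [Finset.card_range]
    ring

/-- Every `E` satisfies m = |E ∩ T| + |E \ T|, and the two preceding sums evaluate the two parts. At
K = 0 the truncated K-1 is harmless, being multiplied by 0. -/
lemma slotProb_recurrence {N m K : ℕ} (hm : m ≤ N) (hK : K ≤ N) :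
    (m : ℝ) * slotProb N m K = 2 * (N - K) * (slotProb N m K - slotProb N m (K + 1)) +
      K * (slotProb N m (K - 1) - slotProb N m K) := by
  have hpos : (0 : ℝ) < N.choose m := by exact_mod_cast Nat.choose_pos hm
  have hsub : Finset.range K ⊆ Finset.range N := Finset.range_subset_range.2 hK
  have h1 := sum_mem_mul_slotWeight (U := Finset.range N) (T := Finset.range K) m
  have h2 := sum_notMem_mul_slotWeight (U := Finset.range N) (T := Finset.range K) m
  rw [slotProb_sum_erase hm hK] at h1
  rw [Finset.sum_congr (s₁ := Finset.range N \ Finset.range K) rfl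
    (g := fun _ => 2 * (slotProb N m K - slotProb N m (K + 1)) * N.choose m)] at h2
  swap
  · intro e he
    rw [slotWeight_eq (Finset.insert_subset (Finset.mem_sdiff.1 he).1 hsub) (by simpa using hm),
      slotWeight_eq hsub (by simpa using hm), Finset.card_insert_of_notMem
      (Finset.mem_sdiff.1 he).2]
    simp only [Finset.card_range]
    ring
  rw [Finset.sum_const, Finset.card_sdiff_of_subset hsub, Finset.card_range, Finset.card_range,
    nsmul_eq_mul, Nat.cast_sub hK] at h2
  have h3 : (m : ℝ) * slotWeight (Finset.range N) (Finset.range K) m =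
      ∑ E ∈ (Finset.range N).powersetCard m, ((E ∩ Finset.range K).card : ℝ) *
          (1 / 2 : ℝ) ^ (E ∩ Finset.range K).card +
      ∑ E ∈ (Finset.range N).powersetCard m, ((E \ Finset.range K).card : ℝ) *
          (1 / 2 : ℝ) ^ (E ∩ Finset.range K).card := by
    rw [slotWeight, Finset.mul_sum, ← Finset.sum_add_distrib]
    refine Finset.sum_congr rfl fun E hE => ?_
    rw [← add_mul, ← (Finset.mem_powersetCard.1 hE).2, ← Finset.card_inter_add_card_sdiff E
      (Finset.range K)]
    push_cast
    ring
  rw [h1, h2, slotWeight_eq hsub (by simpa using hm)] at h3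
  simp only [Finset.card_range] at h3
  apply mul_right_cancel₀ hpos.ne'
  linear_combination h3

/-- Occupied slots are negatively correlated. -/
lemma slotProb_pred_le {N m K : ℕ} (hm : m ≤ N) (hK : K ≤ N) :
    (N : ℝ) * (K * (slotProb N m (K - 1) - slotProb N m K)) ≤ K * m * slotProb N m K := by
  have hpos : (0 : ℝ) < N.choose m := by exact_mod_cast Nat.choose_pos hm
  have hsub : Finset.range K ⊆ Finset.range N := Finset.range_subset_range.2 hK
  have h1 := sum_mem_mul_slotWeight (U := Finset.range N) (T := Finset.range K) m
  rw [slotProb_sum_erase hm hK] at h1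
  -- Chebyshev's sum inequality applies: |E ∩ T| and 2^(-|E ∩ T|) are oppositely ordered, so the
  -- mean of the product is at most the product of the means.
  have hanti : AntivaryOn (fun E : Finset ℕ => ((E ∩ Finset.range K).card : ℝ))
      (fun E : Finset ℕ => (1 / 2 : ℝ) ^ (E ∩ Finset.range K).card)
      (((Finset.range N).powersetCard m : Finset (Finset ℕ)) : Set (Finset ℕ)) := by
    intro E _ F _ h
    by_contra! hlt
    have : (E ∩ Finset.range K).card ≤ (F ∩ Finset.range K).card := by exact_mod_cast hlt.le
    exact absurd (pow_le_pow_of_le_one (by norm_num : (0 : ℝ) ≤ 1 / 2) (by norm_num) this)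
      (not_le.2 h)
  have hch := hanti.card_mul_sum_le_sum_mul_sum
  rw [h1] at hch
  have hcount : (N : ℝ) * ∑ E ∈ (Finset.range N).powersetCard m,
      ((E ∩ Finset.range K).card : ℝ) = K * m * N.choose m := by
    -- Each slot lies in C(N-1,m-1) of the sets, and N C(N-1,m-1) = m C(N,m).
    have key : ∀ e ∈ Finset.range N, (((Finset.range N).powersetCard m).filter (e ∈ ·)).card * N
        = m * N.choose m := by
      intro e he
      cases m with
      | zero => simp
      | succ k =>
        obtain ⟨M, rfl⟩ : ∃ M, N = M + 1 := ⟨N - 1, by omega⟩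
        have h := Finset.powersetCard_succ_insert (Finset.notMem_erase e (Finset.range (M+1))) k
        rw [Finset.insert_erase he] at h
        have hinj : Set.InjOn (insert e) (((Finset.range (M+1)).erase e).powersetCard k :
            Set (Finset ℕ)) := by
          intro A hA B hB h
          have hA' : e ∉ A := fun h => by
            simpa using (Finset.mem_powersetCard.1 hA).1 h
          have hB' : e ∉ B := fun h => by
            simpa using (Finset.mem_powersetCard.1 hB).1 h
          rw [← Finset.erase_insert hA', ← Finset.erase_insert hB', h]
        have h' : ((Finset.range (M+1)).powersetCard (k+1)).filter (e ∈ ·) =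
            (((Finset.range (M+1)).erase e).powersetCard k).image (insert e) := by
          rw [h, Finset.filter_union, Finset.filter_true_of_mem (s := Finset.image _ _),
            Finset.filter_false_of_mem, Finset.empty_union]
          · intro A hA hA'
            simpa using (Finset.mem_powersetCard.1 hA).1 hA'
          · intro A hA
            obtain ⟨B, -, rfl⟩ := Finset.mem_image.1 hA
            simp
        rw [h', Finset.card_image_of_injOn hinj, Finset.card_powersetCard,
          Finset.card_erase_of_mem he, Finset.card_range, Nat.add_sub_cancel]
        rw [mul_comm, Nat.add_one_mul_choose_eq, mul_comm]
    have hsw : ∑ E ∈ (Finset.range N).powersetCard m, (E ∩ Finset.range K).card =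
        ∑ e ∈ Finset.range K, (((Finset.range N).powersetCard m).filter (e ∈ ·)).card := by
      simp_rw [Finset.inter_comm _ (Finset.range K), ← Finset.filter_mem_eq_inter,
        Finset.card_filter]
      exact Finset.sum_comm
    have : N * ∑ E ∈ (Finset.range N).powersetCard m, (E ∩ Finset.range K).card =
        K * m * N.choose m := by
      rw [hsw, mul_comm, Finset.sum_mul, Finset.sum_congr rfl fun e he => key e (hsub he)]
      simp [mul_assoc]
    exact_mod_cast this
  have hW : ∑ E ∈ (Finset.range N).powersetCard m, (1 / 2 : ℝ) ^ (E ∩ Finset.range K).card =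
      slotProb N m K * N.choose m := by
    have := slotWeight_eq hsub (m := m) (by simpa using hm)
    simpa only [Finset.card_range, slotWeight] using this
  rw [hW, Finset.card_powersetCard, Finset.card_range] at hch
  have h5 := mul_le_mul_of_nonneg_left hch (Nat.cast_nonneg (α := ℝ) N)
  rw [← mul_assoc (N : ℝ) (∑ _ ∈ _, _), hcount] at h5
  refine le_of_mul_le_mul_right (a := (N.choose m : ℝ) * N.choose m) ?_ (by positivity)
  linarith

/-- Once the last term of the recurrence is bounded by `slotProb_pred_le`, a positive factor N-K
cancels. -/
lemma slotProb_succ_le {N m K : ℕ} (hm : m ≤ N) (hK : K < N) :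
    slotProb N m (K + 1) ≤ (1 - (m / N : ℝ) / 2) * slotProb N m K := by
  have h1 := slotProb_recurrence hm hK.le
  have h2 := slotProb_pred_le hm hK.le
  have hN : (0 : ℝ) < N := by exact_mod_cast (by omega : 0 < N)
  have hNK : (0 : ℝ) < N - K := by
    have : (K : ℝ) < N := by exact_mod_cast hK
    linarith
  have h3 : (N : ℝ) * (m * slotProb N m K) ≤
      N * (2 * (N - K) * (slotProb N m K - slotProb N m (K + 1))) + K * m * slotProb N m K := by
    rw [h1]; linarith
  have h4 : 0 ≤ (N - K : ℝ) * (2 * N * (slotProb N m K - slotProb N m (K + 1)) -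
      m * slotProb N m K) := by nlinarith
  have h5 := nonneg_of_mul_nonneg_right h4 hNK
  have h6 : (m : ℝ) / N * N = m := div_mul_cancel₀ _ hN.ne'
  refine le_of_mul_le_mul_left ?_ hN
  linear_combination h5 / 2 + slotProb N m K / 2 * h6

lemma slotProb_add_le {N m K : ℕ} (hm : m ≤ N) (L : ℕ) (hK : K + L ≤ N) :
    slotProb N m (K + L) ≤ (1 - (m / N : ℝ) / 2) ^ L * slotProb N m K := by
  induction L with
  | zero => simp
  | succ L ih =>
    have h1 := slotProb_succ_le (K := K + L) hm (by omega)
    have hp : (m : ℝ) / N ≤ 1 := div_le_one_of_le₀ (by exact_mod_cast hm) (by positivity)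
    rw [← add_assoc, pow_succ]
    nlinarith [ih (by omega)]

lemma slotProb_antitone {N m K : ℕ} (hm : m ≤ N) (L : ℕ) (hK : K + L ≤ N) :
    slotProb N m (K + L) ≤ slotProb N m K := by
  refine (slotProb_add_le hm L hK).trans ?_
  have hp : (m : ℝ) / N ≤ 1 := div_le_one_of_le₀ (by exact_mod_cast hm) (by positivity)
  have hp' : 0 ≤ (m : ℝ) / N := by positivity
  have := slotProb_pos hm K
  have h := pow_le_one₀ (n := L) (by linarith : (0 : ℝ) ≤ 1 - (m / N : ℝ) / 2) (by linarith)
  nlinarith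

/-! ### Second-order asymptotics of `slotProb`. -/

/-- The coefficient of the quadratic correction to `slotProb`. -/
noncomputable def tiltCoeff (p : ℝ) : ℝ := p * (1 - p) / (2 - p) ^ 2

lemma tiltCoeff_nonneg {p : ℝ} (h0 : 0 ≤ p) (h1 : p ≤ 1) : 0 ≤ tiltCoeff p :=
  div_nonneg (mul_nonneg h0 (by linarith)) (sq_nonneg _)

lemma tiltCoeff_le_one {p : ℝ} (h1 : p ≤ 1) : tiltCoeff p ≤ 1 := by
  rw [tiltCoeff, div_le_one (by nlinarith)]
  nlinarith

section
variable {N m K : ℕ} {p : ℝ}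

/-- The bound f(K) ≤ (1-p/2) f(K-1) says f(K-1) - f(K) ≥ p/(2-p) f(K). Inserted in the recurrence,
it bounds the next ratio from below. -/
lemma slotProb_succ_ge (hm : m ≤ N) (hp : p = (m : ℝ) / N) (hK : K < N) :
    (1 - p / 2) * (1 - tiltCoeff p * K / (N - K)) * slotProb N m K ≤ slotProb N m (K + 1) := by
  have hN : (0 : ℝ) < N := by exact_mod_cast (by omega : 0 < N)
  have hp0 : 0 ≤ p := by rw [hp]; positivity
  have hp1 : p ≤ 1 := by
    rw [hp]; exact div_le_one_of_le₀ (by exact_mod_cast hm) (by positivity)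
  have hmp : (m : ℝ) = p * N := by rw [hp, div_mul_cancel₀ _ hN.ne']
  have hNK : (0 : ℝ) < N - K := sub_pos.2 (by exact_mod_cast hK)
  have h2p : 0 < 2 - p := by linarith
  have h1 := slotProb_recurrence hm hK.le
  have hd : K * (p / (2 - p) * slotProb N m K) ≤
      K * (slotProb N m (K - 1) - slotProb N m K) := by
    cases K with
    | zero => simp
    | succ k =>
      refine mul_le_mul_of_nonneg_left ?_ (by positivity)
      have := slotProb_succ_le (K := k) hm (by omega)
      rw [← hp] at this
      rw [Nat.add_sub_cancel, div_mul_eq_mul_div, div_le_iff₀ h2p]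
      linarith
  rw [hmp] at h1
  have key : (1 - p / 2) * (1 - tiltCoeff p * K / (N - K)) =
      1 - (p * N - K * (p / (2 - p))) / (2 * (N - K)) := by
    rw [tiltCoeff]
    field_simp
    ring
  rw [key]
  refine le_of_mul_le_mul_left ?_ (by linarith : (0 : ℝ) < 2 * (N - K))
  rw [← mul_assoc, mul_sub, mul_one, mul_div_cancel₀ _ (by positivity)]
  linarith

/-- The same substitution once more, now with the lower ratio bound: f(K-1) - f(K) ≤ (p/(2-p) +
O(K/N)) f(K), an error that moves the ratio by only O((K/N)^2). -/
lemma slotProb_succ_le' (hm : m ≤ N) (hp : p = (m : ℝ) / N) (hN : 0 < N) (hK : 4 * K ≤ N) :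
    slotProb N m (K + 1) ≤
      (1 - p / 2) * (1 - tiltCoeff p * K / (N - K) + 16 * (K / N) ^ 2) * slotProb N m K := by
  have hN' : (0 : ℝ) < N := by exact_mod_cast hN
  have hp0 : 0 ≤ p := by rw [hp]; positivity
  have hp1 : p ≤ 1 := by
    rw [hp]; exact div_le_one_of_le₀ (by exact_mod_cast hm) (by positivity)
  have hmp : (m : ℝ) = p * N := by rw [hp, div_mul_cancel₀ _ hN'.ne']
  have hK' : 4 * (K : ℝ) ≤ N := by exact_mod_cast hK
  have hK0 : (0 : ℝ) ≤ K := by positivity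
  have hNK : (0 : ℝ) < N - K := by linarith
  have h2p : 0 < 2 - p := by linarith
  have hf := slotProb_pos hm K
  have h1 := slotProb_recurrence (K := K) hm (by omega)
  have hg0 := tiltCoeff_nonneg hp0 hp1
  have hg1 := tiltCoeff_le_one hp1
  have hd : K * (slotProb N m (K - 1) - slotProb N m K) ≤
      K * ((p / (2 - p) + 8 * (K / N)) * slotProb N m K) := by
    cases K with
    | zero => simp
    | succ k =>
      refine mul_le_mul_of_nonneg_left ?_ (by positivity)
      have := slotProb_succ_ge (K := k) hm hp (by omega)
      rw [Nat.add_sub_cancel]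
      push_cast at *
      set g := tiltCoeff p
      have hk0 : (0 : ℝ) ≤ k := by positivity
      have hx : g * k / (N - k) ≤ 2 * ((k + 1) / N) := by
        rw [div_le_iff₀ (by linarith)]
        have h3 : (k + 1 : ℝ) / N * N = k + 1 := div_mul_cancel₀ _ hN'.ne'
        have h4 : 0 ≤ (k + 1 : ℝ) / N := by positivity
        nlinarith
      have hq : (k + 1 : ℝ) / N ≤ 1 / 4 := by
        rw [div_le_iff₀ hN']; linarith
      have hq0 : 0 ≤ (k + 1 : ℝ) / N := by positivity
      have hfk := slotProb_pos hm k
      set q := (k + 1 : ℝ) / N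
      have h5 : (1 - p / 2) * (1 - 2 * q) * slotProb N m k ≤ slotProb N m (k + 1) := by
        refine le_trans ?_ this
        refine mul_le_mul_of_nonneg_right ?_ hfk.le
        exact mul_le_mul_of_nonneg_left (by linarith) (by linarith)
      -- This uses 1/(1-2q) ≤ 1+4q for 0 ≤ q ≤ 1/4.
      have h6 : (1 - p / 2) * slotProb N m k ≤ (1 + 4 * q) * slotProb N m (k + 1) := by
        have h7 : (1 + 4 * q) * ((1 - p / 2) * (1 - 2 * q) * slotProb N m k) ≤
            (1 + 4 * q) * slotProb N m (k + 1) := mul_le_mul_of_nonneg_left h5 (by linarith)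
        refine le_trans ?_ h7
        have h8 : 0 ≤ (1 - p / 2) * slotProb N m k := by
          apply mul_nonneg _ hfk.le
          linarith
        nlinarith [mul_nonneg hq0 (by linarith : 0 ≤ 1 / 4 - q)]
      have h9 : p / (2 - p) + 8 * q = (p + 8 * q * (2 - p)) / (2 - p) := by
        field_simp
      rw [h9, div_mul_eq_mul_div, le_div_iff₀ h2p]
      nlinarith [mul_nonneg (mul_nonneg hq0 hf.le) (by linarith : 0 ≤ 1 - p)]
  rw [hmp] at h1
  have key : (1 - p / 2) * (1 - tiltCoeff p * K / (N - K)) =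
      1 - (p * N - K * (p / (2 - p))) / (2 * (N - K)) := by
    rw [tiltCoeff]
    field_simp
    ring
  have hsq : (K : ℝ) * (8 * (K / N)) ≤ 2 * (N - K) * ((1 - p / 2) * (16 * (K / N) ^ 2)) := by
    have h3 : (K : ℝ) / N * N = K := div_mul_cancel₀ _ hN'.ne'
    have h4 : 0 ≤ (K : ℝ) / N := by positivity
    have h6 : (1 / 2 : ℝ) ≤ 1 - p / 2 := by linarith
    have h7 : (K : ℝ) * (8 * (K / N)) = 2 * (N / 2) * (1 / 2 * (16 * (K / N) ^ 2)) := by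
      field_simp; ring
    rw [h7]
    gcongr
    linarith
  rw [mul_add, key]
  refine le_of_mul_le_mul_left ?_ (by linarith : (0 : ℝ) < 2 * (N - K))
  have hA : 2 * ((N : ℝ) - K) * (1 - (p * N - K * (p / (2 - p))) / (2 * (N - K))) =
      2 * (N - K) - (p * N - K * (p / (2 - p))) := by
    rw [mul_sub, mul_one, mul_div_cancel₀ _ (by positivity)]
  rw [← mul_assoc, mul_add, hA]
  have := mul_le_mul_of_nonneg_right hsq hf.le
  linarith

lemma slotProb_succ_bounds (hm : m ≤ N) (hp : p = (m : ℝ) / N) (hN : 0 < N) (hK : 4 * K ≤ N) :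
    (1 - p / 2) * Real.exp (-(tiltCoeff p * (K / N)) - 4 * (K / N) ^ 2) * slotProb N m K ≤
        slotProb N m (K + 1) ∧
      slotProb N m (K + 1) ≤
        (1 - p / 2) * Real.exp (-(tiltCoeff p * (K / N)) + 16 * (K / N) ^ 2) * slotProb N m K := by
  have hN' : (0 : ℝ) < N := by exact_mod_cast hN
  have hp0 : 0 ≤ p := by rw [hp]; positivity
  have hp1 : p ≤ 1 := by
    rw [hp]; exact div_le_one_of_le₀ (by exact_mod_cast hm) (by positivity)
  have hK' : 4 * (K : ℝ) ≤ N := by exact_mod_cast hK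
  have hK0 : (0 : ℝ) ≤ K := by positivity
  have hNK : (0 : ℝ) < N - K := by linarith
  have hf := slotProb_pos hm K
  have hg0 := tiltCoeff_nonneg hp0 hp1
  have hg1 := tiltCoeff_le_one hp1
  set g := tiltCoeff p
  have hq : (K : ℝ) / N ≤ 1 / 4 := by rw [div_le_iff₀ hN']; linarith
  have hq0 : 0 ≤ (K : ℝ) / N := by positivity
  have hx : g * K / (N - K) = g * (K / N) / (1 - K / N) := by
    field_simp
  have hlo := slotProb_succ_ge hm hp (by omega : K < N)
  have hup := slotProb_succ_le' hm hp hN hK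
  change (1 - p / 2) * (1 - g * K / (N - K)) * _ ≤ _ at hlo
  change _ ≤ (1 - p / 2) * (1 - g * K / (N - K) + _) * _ at hup
  rw [hx] at hlo hup
  set q := (K : ℝ) / N
  have h1q : 0 < 1 - q := by linarith
  constructor
  · refine le_trans ?_ hlo
    refine mul_le_mul_of_nonneg_right (mul_le_mul_of_nonneg_left ?_ (by linarith)) hf.le
    have hy : 0 < 1 - q - g * q := by nlinarith
    -- With x = gq/(1-q), one has 1-x = 1/(1 + x/(1-x)) ≥ exp(-x/(1-x)), and x/(1-x) = gq/(1-q-gq).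
    have e1 := Real.add_one_le_exp (g * q / (1 - q - g * q))
    have e2 : g * q / (1 - q - g * q) ≤ g * q + 4 * q ^ 2 := by
      rw [div_le_iff₀ hy]
      have : 0 ≤ g * q * (1 - g) := by apply mul_nonneg; positivity; linarith
      have h2 : (g * q + 4 * q ^ 2) * (1 - 2 * q) ≤ (g * q + 4 * q ^ 2) * (1 - q - g * q) := by
        apply mul_le_mul_of_nonneg_left _ (by positivity)
        nlinarith
      refine le_trans ?_ h2
      nlinarith [mul_nonneg (sq_nonneg q) (by linarith : 0 ≤ 1 - g),
        mul_nonneg (sq_nonneg q) (by linarith : 0 ≤ 1 / 4 - q)]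
    have e3 : 1 - g * q / (1 - q) = (g * q / (1 - q - g * q) + 1)⁻¹ := by
      field_simp
      ring
    rw [e3, show -(g * q) - 4 * q ^ 2 = -(g * q + 4 * q ^ 2) by ring, Real.exp_neg]
    apply inv_anti₀
    · have : 0 ≤ g * q / (1 - q - g * q) := by positivity
      linarith
    · exact e1.trans (Real.exp_le_exp.2 e2)
  · refine hup.trans ?_
    refine mul_le_mul_of_nonneg_right (mul_le_mul_of_nonneg_left ?_ (by linarith)) hf.le
    have e1 := Real.add_one_le_exp (-(g * q) + 16 * q ^ 2)
    have e2 : g * q ≤ g * q / (1 - q) := by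
      rw [le_div_iff₀ h1q]
      nlinarith [mul_nonneg hg0 (sq_nonneg q)]
    linarith

/-- The consecutive ratios are multiplied: the linear terms k/N sum to K(K-1)/(2N), and the
quadratic errors are absorbed by k^2 ≤ (k+1)^3 - k^3. -/
lemma slotProb_bounds (hm : m ≤ N) (hp : p = (m : ℝ) / N) (hN : 0 < N) (hK : 4 * K ≤ N) :
    (1 - p / 2) ^ K * Real.exp (-(tiltCoeff p * (K * (K - 1) / (2 * N))) -
        16 * (K ^ 3 / (N : ℝ) ^ 2)) ≤ slotProb N m K ∧
      slotProb N m K ≤ (1 - p / 2) ^ K * Real.exp (-(tiltCoeff p * (K * (K - 1) / (2 * N))) +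
        16 * (K ^ 3 / (N : ℝ) ^ 2)) := by
  have hN' : (0 : ℝ) < N := by exact_mod_cast hN
  have hp1 : p ≤ 1 := by
    rw [hp]; exact div_le_one_of_le₀ (by exact_mod_cast hm) (by positivity)
  have h1p : 0 < 1 - p / 2 := by linarith
  induction K with
  | zero => simp [slotProb_zero hm]
  | succ k ih =>
    obtain ⟨ih1, ih2⟩ := ih (by omega)
    obtain ⟨h1, h2⟩ := slotProb_succ_bounds (K := k) hm hp hN (by omega)
    set g := tiltCoeff p
    have hk : (0 : ℝ) ≤ k := by positivity
    have hd : (k / N : ℝ) ^ 2 ≤ (k + 1) ^ 3 / (N : ℝ) ^ 2 - k ^ 3 / (N : ℝ) ^ 2 := by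
      rw [← sub_div, div_pow]
      gcongr
      nlinarith [pow_nonneg hk 2]
    have he : g * ((k + 1) * (k + 1 - 1) / (2 * N)) = g * (k * (k - 1) / (2 * N)) + g * (k / N) := by
      field_simp
      ring
    have hsq : 0 ≤ (k / N : ℝ) ^ 2 := sq_nonneg _
    push_cast
    rw [he, pow_succ]
    constructor
    · refine le_trans ?_ h1
      refine le_trans ?_ (mul_le_mul_of_nonneg_left ih1 (by positivity))
      have : (1 - p / 2) * Real.exp (-(g * (k / N)) - 4 * (k / N) ^ 2) *
          ((1 - p / 2) ^ k * Real.exp (-(g * (k * (k - 1) / (2 * N))) - 16 * (k ^ 3 / N ^ 2))) =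
          (1 - p / 2) ^ k * (1 - p / 2) * Real.exp ((-(g * (k / N)) - 4 * (k / N) ^ 2) +
            (-(g * (k * (k - 1) / (2 * N))) - 16 * (k ^ 3 / N ^ 2))) := by
        rw [Real.exp_add]; ring
      rw [this]
      exact mul_le_mul_of_nonneg_left (Real.exp_le_exp.2 (by linarith)) (by positivity)
    · refine h2.trans ?_
      refine (mul_le_mul_of_nonneg_left ih2 (by positivity)).trans ?_
      have : (1 - p / 2) * Real.exp (-(g * (k / N)) + 16 * (k / N) ^ 2) *
          ((1 - p / 2) ^ k * Real.exp (-(g * (k * (k - 1) / (2 * N))) + 16 * (k ^ 3 / N ^ 2))) =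
          (1 - p / 2) ^ k * (1 - p / 2) * Real.exp ((-(g * (k / N)) + 16 * (k / N) ^ 2) +
            (-(g * (k * (k - 1) / (2 * N))) + 16 * (k ^ 3 / N ^ 2))) := by
        rw [Real.exp_add (-(g * (k / N)) + 16 * (k / N) ^ 2)]; ring
      rw [this]
      exact mul_le_mul_of_nonneg_left (Real.exp_le_exp.2 (by linarith)) (by positivity)

end

/-! ### Probabilities under `orientedGnm` as averages over edge sets. -/

instance {V : Type*} [Countable V] : MeasurableSingletonClass (SimpleGraph V) where
  measurableSet_singleton G := by
    have := SimpleGraph.measurable_edgeSet (V := V) (measurableSet_singleton G.edgeSet)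
    convert this using 1
    ext H
    simp

/-- The possible edges on the vertex set `Fin n`. -/
def slots (n : ℕ) : Finset (Sym2 (Fin n)) := Finset.univ.filter fun e => ¬ e.IsDiag

lemma mem_slots {n : ℕ} {e : Sym2 (Fin n)} : e ∈ slots n ↔ ¬ e.IsDiag := by simp [slots]

lemma card_slots (n : ℕ) : (slots n).card = n.choose 2 := by
  rw [slots, ← Fintype.card_subtype, Sym2.card_subtype_not_diag, Fintype.card_fin]

lemma edgeSet_fromEdgeSet_of_subset {n : ℕ} {E : Finset (Sym2 (Fin n))} (hE : E ⊆ slots n) :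
    (SimpleGraph.fromEdgeSet (E : Set (Sym2 (Fin n)))).edgeSet = E := by
  rw [SimpleGraph.edgeSet_fromEdgeSet, sdiff_eq_left, Set.disjoint_left]
  intro e he h
  exact mem_slots.1 (hE he) h

lemma setOf_ncard_edgeSet (n m : ℕ) :
    {G : SimpleGraph (Fin n) | G.edgeSet.ncard = m} =
      (fun E : Finset (Sym2 (Fin n)) => SimpleGraph.fromEdgeSet (E : Set (Sym2 (Fin n)))) ''
        ((slots n).powersetCard m : Set (Finset (Sym2 (Fin n)))) := by
  classical
  ext G
  simp only [Set.mem_ofPred_eq, Set.mem_image, Finset.mem_coe, Finset.mem_powersetCard]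
  constructor
  · intro h
    refine ⟨G.edgeSet.toFinset, ⟨?_, ?_⟩, by simp⟩
    · intro e he
      exact mem_slots.2 (G.not_isDiag_of_mem_edgeSet (by simpa using he))
    · rw [← h, Set.ncard_eq_toFinset_card']
  · rintro ⟨E, ⟨hE, hc⟩, rfl⟩
    rw [edgeSet_fromEdgeSet_of_subset hE, Set.ncard_coe_finset, hc]

lemma injOn_fromEdgeSet (n m : ℕ) :
    Set.InjOn (fun E : Finset (Sym2 (Fin n)) =>
      SimpleGraph.fromEdgeSet (E : Set (Sym2 (Fin n))))
      ((slots n).powersetCard m : Set (Finset (Sym2 (Fin n)))) := by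
  intro E hE F hF h
  have h' := congrArg SimpleGraph.edgeSet h
  simp only [edgeSet_fromEdgeSet_of_subset (Finset.mem_powersetCard.1 hE).1,
    edgeSet_fromEdgeSet_of_subset (Finset.mem_powersetCard.1 hF).1] at h'
  exact_mod_cast h'

lemma isProbabilityMeasure_gnm {n m : ℕ} (hm : m ≤ n.choose 2) :
    IsProbabilityMeasure (gnm n m) := by
  refine isProbabilityMeasure_uniformOn (Set.toFinite _) ?_
  rw [setOf_ncard_edgeSet]
  refine Set.Nonempty.image _ ?_
  rw [Finset.coe_nonempty, Finset.powersetCard_nonempty, card_slots]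
  exact hm

instance (n : ℕ) : IsProbabilityMeasure (fairCoins n) :=
  inferInstanceAs (IsProbabilityMeasure (uniformOn Set.univ))

lemma isProbabilityMeasure_orientedGnm {n m : ℕ} (hm : m ≤ n.choose 2) :
    IsProbabilityMeasure (orientedGnm n m) := by
  have := isProbabilityMeasure_gnm hm
  exact inferInstanceAs (IsProbabilityMeasure ((gnm n m).prod (fairCoins n)))

lemma fairCoins_real {n : ℕ} (B : Set (Sym2 (Fin n) → Bool)) :
    (fairCoins n).real B = B.ncard / 2 ^ Fintype.card (Sym2 (Fin n)) := by
  rw [measureReal_def, fairCoins, uniformOn_univ, Measure.count_apply (Set.toFinite B).measurableSet,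
    ENNReal.toReal_div, ← (Set.toFinite B).cast_ncard_eq,
    ENat.toENNReal_coe, ENNReal.toReal_natCast]
  simp

lemma orientedGnm_real_eq_sum {n m : ℕ} (hm : m ≤ n.choose 2)
    (A : Set (SimpleGraph (Fin n) × (Sym2 (Fin n) → Bool))) :
    (orientedGnm n m).real A =
      ∑ G, (gnm n m).real {G} * (fairCoins n).real {c | (G, c) ∈ A} := by
  classical
  have := isProbabilityMeasure_gnm hm
  rw [measureReal_def, orientedGnm, Measure.prod_apply (Set.toFinite A).measurableSet,
    lintegral_fintype, ENNReal.toReal_sum]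
  · refine Finset.sum_congr rfl fun G _ => ?_
    rw [ENNReal.toReal_mul, mul_comm]
    rfl
  · intro G _
    exact ENNReal.mul_ne_top (measure_ne_top _ _) (measure_ne_top _ _)

lemma gnm_real_singleton {n m : ℕ} (G : SimpleGraph (Fin n)) [Decidable (G.edgeSet.ncard = m)] :
    (gnm n m).real {G} = if G.edgeSet.ncard = m then 1 / ((n.choose 2).choose m : ℝ) else 0 := by
  classical
  have hS : {G : SimpleGraph (Fin n) | G.edgeSet.ncard = m} =
      ((((slots n).powersetCard m).image fun E : Finset (Sym2 (Fin n)) =>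
        SimpleGraph.fromEdgeSet (E : Set (Sym2 (Fin n)))) : Set _) := by
    rw [Finset.coe_image, setOf_ncard_edgeSet]
  have hmem : G ∈ (((slots n).powersetCard m).image fun E : Finset (Sym2 (Fin n)) =>
        SimpleGraph.fromEdgeSet (E : Set (Sym2 (Fin n)))) ↔ G.edgeSet.ncard = m := by
    rw [← Finset.mem_coe, ← hS]; rfl
  rw [measureReal_def, gnm, hS, ← Finset.coe_singleton, uniformOn_apply_finset,
    Finset.card_image_of_injOn (injOn_fromEdgeSet n m), Finset.card_powersetCard, card_slots]
  split_ifs with h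
  · rw [Finset.inter_singleton_of_mem (hmem.2 h)]
    simp
  · rw [Finset.inter_singleton_of_notMem (mt hmem.1 h)]
    simp

lemma orientedGnm_real {n m : ℕ} (hm : m ≤ n.choose 2)
    (A : Set (SimpleGraph (Fin n) × (Sym2 (Fin n) → Bool))) :
    (orientedGnm n m).real A =
      (∑ E ∈ (slots n).powersetCard m, (fairCoins n).real
        {c | (SimpleGraph.fromEdgeSet (E : Set (Sym2 (Fin n))), c) ∈ A}) /
        (n.choose 2).choose m := by
  classical
  rw [orientedGnm_real_eq_sum hm]
  simp_rw [gnm_real_singleton, ite_mul, zero_mul]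
  rw [← Finset.sum_filter, Finset.sum_div]
  have hS : Finset.univ.filter (fun G : SimpleGraph (Fin n) => G.edgeSet.ncard = m) =
      (((slots n).powersetCard m).image fun E : Finset (Sym2 (Fin n)) =>
        SimpleGraph.fromEdgeSet (E : Set (Sym2 (Fin n)))) := by
    rw [← Finset.coe_inj, Finset.coe_image, ← setOf_ncard_edgeSet]
    simp
  rw [hS, Finset.sum_image (injOn_fromEdgeSet n m)]
  refine Finset.sum_congr rfl fun E _ => ?_
  ring

/-- The event that every present edge in `T` has its coin given by `d`. -/
def coinsOn {n : ℕ} (T : Finset (Sym2 (Fin n))) (d : Sym2 (Fin n) → Bool) :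
    Set (SimpleGraph (Fin n) × (Sym2 (Fin n) → Bool)) :=
  {ω | ∀ e ∈ T, e ∈ ω.1.edgeSet → ω.2 e = d e}

/-- The event that no edge in `T` is present. -/
def noEdgesIn {n : ℕ} (T : Finset (Sym2 (Fin n))) :
    Set (SimpleGraph (Fin n) × (Sym2 (Fin n) → Bool)) :=
  {ω | ∀ e ∈ T, e ∉ ω.1.edgeSet}

lemma fairCoins_real_agree {n : ℕ} (S : Finset (Sym2 (Fin n))) (d : Sym2 (Fin n) → Bool) :
    (fairCoins n).real {c | ∀ e ∈ S, c e = d e} = (1 / 2 : ℝ) ^ S.card := by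
  classical
  have h : {c : Sym2 (Fin n) → Bool | ∀ e ∈ S, c e = d e} =
      (Fintype.piFinset fun e => if e ∈ S then {d e} else Finset.univ : Finset _) := by
    ext c
    simp only [Set.mem_ofPred_eq, Finset.mem_coe, Fintype.mem_piFinset]
    refine forall_congr' fun e => ?_
    by_cases he : e ∈ S <;> simp [he]
  rw [fairCoins_real, h, Set.ncard_coe_finset, Fintype.card_piFinset]
  have h2 : ∀ e, ((if e ∈ S then {d e} else Finset.univ : Finset Bool)).card =
      if e ∈ S then 1 else 2 := by
    intro e
    split_ifs <;> simp
  simp_rw [h2]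
  rw [Finset.prod_ite]
  simp only [Finset.prod_const, one_pow, one_mul]
  have h3 := Finset.card_filter_add_card_filter_not (s := Finset.univ) (fun e => e ∈ S)
  rw [Finset.filter_mem_eq_inter, Finset.univ_inter, Finset.card_univ] at h3
  rw [← h3, pow_add]
  push_cast
  field_simp
  rw [← mul_pow]
  norm_num

/-- Given the edge set `E`, exactly the |E ∩ T| coins on present edges are constrained, so the
conditional probability is 2^(-|E ∩ T|). -/
lemma orientedGnm_real_coinsOn {n m : ℕ} (hm : m ≤ n.choose 2) {T : Finset (Sym2 (Fin n))}
    (hT : T ⊆ slots n) (d : Sym2 (Fin n) → Bool) :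
    (orientedGnm n m).real (coinsOn T d) = slotProb (n.choose 2) m T.card := by
  classical
  have hpos : (0 : ℝ) < (n.choose 2).choose m := by exact_mod_cast Nat.choose_pos hm
  have h := slotWeight_eq hT (m := m) (by rwa [card_slots])
  rw [card_slots] at h
  rw [orientedGnm_real hm, div_eq_iff hpos.ne', ← h, slotWeight]
  refine Finset.sum_congr rfl fun E hE => ?_
  rw [← fairCoins_real_agree _ d]
  congr 1
  ext c
  simp only [coinsOn, Set.mem_ofPred_eq, Finset.mem_inter,
    edgeSet_fromEdgeSet_of_subset (Finset.mem_powersetCard.1 hE).1, Finset.mem_coe]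
  exact ⟨fun h e he => h e he.2 he.1, fun h e h1 h2 => h e ⟨h2, h1⟩⟩

/-- Each removed slot costs a factor C(M,m)/C(M+1,m) = 1 - m/(M+1) ≤ 1 - m/N when m ≤ M; otherwise
C(M,m) = 0. -/
lemma choose_sub_le {N m K : ℕ} (hm : m ≤ N) (hK : K ≤ N) :
    ((N - K).choose m : ℝ) ≤ (1 - (m : ℝ) / N) ^ K * N.choose m := by
  induction K with
  | zero => simp
  | succ K ih =>
    have ih := ih (by omega)
    obtain ⟨M, hM⟩ : ∃ M, N - K = M + 1 := ⟨N - K - 1, by omega⟩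
    have hM' : N - (K + 1) = M := by omega
    rw [hM']
    rw [hM] at ih
    have hN : (0 : ℝ) < N := by exact_mod_cast (by omega : 0 < N)
    have hp1 : (m : ℝ) / N ≤ 1 := div_le_one_of_le₀ (by exact_mod_cast hm) (by positivity)
    have hstep : (M.choose m : ℝ) ≤ (1 - (m : ℝ) / N) * (M + 1).choose m := by
      rcases lt_or_ge M m with h | h
      · rw [Nat.choose_eq_zero_of_lt h]
        have : 0 ≤ 1 - (m : ℝ) / N := by linarith
        push_cast
        positivity
      · have h1 : (M.choose m : ℝ) * (M + 1) = (M + 1).choose m * (M + 1 - m) := by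
          have := Nat.choose_mul_succ_eq M m
          have h2 : ((M + 1 - m : ℕ) : ℝ) = M + 1 - m := by push_cast [Nat.cast_sub (by omega : m ≤ M + 1)]; rfl
          rw [← h2]
          exact_mod_cast this
        have hMN : (M : ℝ) + 1 ≤ N := by exact_mod_cast (by omega : M + 1 ≤ N)
        have h3 : (m : ℝ) / N ≤ m / (M + 1) := by gcongr
        have h4 : (M.choose m : ℝ) = (1 - m / (M + 1)) * (M + 1).choose m := by
          field_simp
          linarith
        rw [h4]
        gcongr
    rw [pow_succ]
    have := mul_le_mul_of_nonneg_left ih (by linarith : 0 ≤ 1 - (m : ℝ) / N)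
    linarith

lemma orientedGnm_real_noEdgesIn_le {n m : ℕ} (hm : m ≤ n.choose 2) {T : Finset (Sym2 (Fin n))}
    (hT : T ⊆ slots n) :
    (orientedGnm n m).real (noEdgesIn T) ≤ (1 - edgeDensity n m) ^ T.card := by
  classical
  have hpos : (0 : ℝ) < (n.choose 2).choose m := by exact_mod_cast Nat.choose_pos hm
  have hc : T.card ≤ n.choose 2 := by rw [← card_slots]; exact Finset.card_le_card hT
  rw [orientedGnm_real hm, div_le_iff₀ hpos]
  refine le_trans (le_of_eq ?_) (choose_sub_le hm hc)
  rw [← card_slots, ← Finset.card_sdiff_of_subset hT, ← Finset.card_powersetCard,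
    Finset.card_eq_sum_ones, Nat.cast_sum]
  have hsub : (slots n \ T).powersetCard m ⊆ (slots n).powersetCard m :=
    Finset.powersetCard_mono Finset.sdiff_subset
  rw [← Finset.sum_subset hsub]
  · refine Finset.sum_congr rfl fun E hE => ?_
    have hE' := Finset.mem_powersetCard.1 (hsub hE)
    have : {c | (SimpleGraph.fromEdgeSet (E : Set (Sym2 (Fin n))), c) ∈ noEdgesIn T} =
        Set.univ := by
      rw [Set.eq_univ_iff_forall]
      intro c e he h
      rw [edgeSet_fromEdgeSet_of_subset hE'.1] at h
      exact (Finset.mem_sdiff.1 ((Finset.mem_powersetCard.1 hE).1 h)).2 he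
    rw [this]
    simp
  · intro E hE hE2
    have hE' := Finset.mem_powersetCard.1 hE
    have : {c | (SimpleGraph.fromEdgeSet (E : Set (Sym2 (Fin n))), c) ∈ noEdgesIn T} = ∅ := by
      rw [Set.eq_empty_iff_forall_notMem]
      intro c hc
      refine hE2 (Finset.mem_powersetCard.2 ⟨fun e he => ?_, hE'.2⟩)
      refine Finset.mem_sdiff.2 ⟨hE'.1 he, fun h => hc e h ?_⟩
      rw [edgeSet_fromEdgeSet_of_subset hE'.1]
      exact he
    rw [this]
    simp

/-! ### Invariance under relabelling the vertices. -/

/-- The coin that has to be added to the coin of `σ e` when the vertices are relabelled by `σ`. -/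
def orderFlip {n : ℕ} (σ : Equiv.Perm (Fin n)) : Sym2 (Fin n) → Bool :=
  Sym2.lift ⟨fun u v => decide (u ≠ v ∧ ¬ (u < v ↔ σ u < σ v)), by
    intro u v
    rcases lt_trichotomy u v with h | rfl | h
    · have : σ u ≠ σ v := fun h' => h.ne (σ.injective h')
      rcases lt_or_gt_of_ne this with h' | h' <;>
        simp [h, h', h.ne, h.ne', h.not_gt, h'.not_gt]
    · simp
    · have : σ u ≠ σ v := fun h' => h.ne' (σ.injective h')
      rcases lt_or_gt_of_ne this with h' | h' <;>
        simp [h, h', h.ne, h.ne', h.not_gt, h'.not_gt]⟩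

/-- Relabelling the vertices of an oriented graph. -/
def relabelCoins {n : ℕ} (σ : Equiv.Perm (Fin n)) (c : Sym2 (Fin n) → Bool) :
    Sym2 (Fin n) → Bool :=
  fun e => xor (c (e.map σ)) (orderFlip σ e)

lemma relabelCoins_bijective {n : ℕ} (σ : Equiv.Perm (Fin n)) :
    Function.Bijective (relabelCoins σ) := by
  refine Finite.injective_iff_bijective.1 fun c c' h => ?_
  funext e
  have := congrFun h (e.map σ.symm)
  simpa [relabelCoins, Sym2.map_map] using this

lemma orientedGraph_relabel {n : ℕ} (σ : Equiv.Perm (Fin n)) (G : SimpleGraph (Fin n))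
    (c : Sym2 (Fin n) → Bool) (u v : Fin n) :
    (orientedGraph (G.comap σ, relabelCoins σ c)).Adj u v ↔
      (orientedGraph (G, c)).Adj (σ u) (σ v) := by
  simp only [orientedGraph, SimpleGraph.comap_adj]
  refine and_congr_right fun h => ?_
  have huv : u ≠ v := fun h' => h.ne (congrArg σ h')
  simp only [relabelCoins, orderFlip, Sym2.map_mk, Sym2.lift_mk]
  by_cases h1 : u < v <;> by_cases h2 : σ u < σ v <;> cases c s(σ u, σ v) <;>
    simp [h1, h2, huv]

/-- Relabelling permutes the graphs and preserves the number of edges; it also permutes the coin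
families. Both uniform laws are therefore invariant. -/
lemma orientedGnm_real_relabel {n m : ℕ} (hm : m ≤ n.choose 2) (σ : Equiv.Perm (Fin n))
    (A : Set (SimpleGraph (Fin n) × (Sym2 (Fin n) → Bool))) :
    (orientedGnm n m).real {ω | (ω.1.comap σ, relabelCoins σ ω.2) ∈ A} =
      (orientedGnm n m).real A := by
  classical
  have hbij : Function.Bijective fun G : SimpleGraph (Fin n) => G.comap σ := by
    refine Finite.injective_iff_bijective.1 fun G H h => ?_
    ext u v
    have := congrArg (fun G => G.Adj (σ.symm u) (σ.symm v)) h
    simpa using this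
  rw [orientedGnm_real_eq_sum hm, orientedGnm_real_eq_sum hm]
  refine Function.Bijective.sum_comp hbij (fun G => (gnm n m).real {G} *
    (fairCoins n).real {c | (G, c) ∈ A}) |>.symm ▸ ?_
  refine Finset.sum_congr rfl fun G _ => ?_
  congr 1
  · rw [gnm_real_singleton, gnm_real_singleton]
    have : (G.comap σ).edgeSet.ncard = G.edgeSet.ncard :=
      Nat.card_congr (SimpleGraph.Iso.comap σ G).mapEdgeSet
    rw [this]
  · rw [fairCoins_real, fairCoins_real]
    congr 2
    refine Set.ncard_congr (fun c _ => relabelCoins σ c) (fun c hc => hc)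
      (fun c c' _ _ h => (relabelCoins_bijective σ).1 h) fun c hc => ?_
    obtain ⟨c', rfl⟩ := (relabelCoins_bijective σ).2 c
    exact ⟨c', hc, rfl⟩

lemma notReach_relabel {n : ℕ} (σ : Equiv.Perm (Fin n)) (u v : Fin n)
    (ω : SimpleGraph (Fin n) × (Sym2 (Fin n) → Bool)) :
    (ω.1.comap σ, relabelCoins σ ω.2) ∈ notReach u v ↔ ω ∈ notReach (σ u) (σ v) := by
  simp only [notReach, Set.mem_ofPred_eq, not_iff_not]
  have hadj := orientedGraph_relabel σ ω.1 ω.2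
  constructor
  · intro h
    exact h.lift σ fun a b hab => (hadj a b).1 hab
  · intro h
    have := h.lift (p := (orientedGraph (ω.1.comap σ, relabelCoins σ ω.2)).Adj) σ.symm
      fun a b hab => (hadj _ _).2 (by simpa using hab)
    simpa [Function.onFun] using this

lemma orientedGraph_irrefl {n : ℕ} (ω : SimpleGraph (Fin n) × (Sym2 (Fin n) → Bool)) (u : Fin n) :
    ¬ (orientedGraph ω).Adj u u := fun h => h.1.ne rfl

/-! ### Forbidden arcs and union bounds for rare events. -/

/-- The event that none of the arcs in `R` is present. -/
def noArcs {n : ℕ} (R : Finset (Fin n × Fin n)) :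
    Set (SimpleGraph (Fin n) × (Sym2 (Fin n) → Bool)) :=
  {ω | ∀ q ∈ R, ¬ (orientedGraph ω).Adj q.1 q.2}

/-- No arc occurs together with its reverse, so the arcs sit on distinct pairs. Forbidding one
prescribes the coin of its pair: `true` exactly when the forbidden arc goes from the larger to the
smaller vertex. -/
lemma orientedGnm_real_noArcs {n m : ℕ} (hm : m ≤ n.choose 2) (R : Finset (Fin n × Fin n))
    (hR : ∀ u v, (u, v) ∈ R → (v, u) ∉ R) :
    (orientedGnm n m).real (noArcs R) = slotProb (n.choose 2) m R.card := by
  classical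
  have hne : ∀ u v, (u, v) ∈ R → u ≠ v := by
    rintro u v h rfl
    exact hR u u h h
  have hinj : Set.InjOn (fun q : Fin n × Fin n => s(q.1, q.2)) (R : Set (Fin n × Fin n)) := by
    rintro ⟨u, v⟩ h ⟨u', v'⟩ h' heq
    rcases Sym2.eq_iff.1 heq with ⟨h1, h2⟩ | ⟨h1, h2⟩
    · exact Prod.ext h1 h2
    · dsimp only at h1 h2
      subst h1 h2
      exact absurd h' (hR _ _ h)
  have hsub : R.image (fun q => s(q.1, q.2)) ⊆ slots n := by
    intro e he
    obtain ⟨⟨u, v⟩, h, rfl⟩ := Finset.mem_image.1 he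
    exact mem_slots.2 (by simpa using hne u v h)
  rw [← Finset.card_image_of_injOn hinj, ← orientedGnm_real_coinsOn hm hsub
    (fun e => decide (∃ u v, e = s(u, v) ∧ (u, v) ∈ R ∧ v < u))]
  congr 1
  ext ω
  simp only [noArcs, coinsOn, Set.mem_ofPred_eq, Finset.mem_image, forall_exists_index, and_imp,
    Prod.forall]
  have hd : ∀ u v, (u, v) ∈ R →
      ((∃ u' v', s(u, v) = s(u', v') ∧ (u', v') ∈ R ∧ v' < u') ↔ ¬ u < v) := by
    intro u v h
    constructor
    · rintro ⟨u', v', heq, h', hlt⟩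
      rcases Sym2.eq_iff.1 heq with ⟨rfl, rfl⟩ | ⟨rfl, rfl⟩
      · exact hlt.not_gt
      · exact absurd h' (hR _ _ h)
    · intro hlt
      exact ⟨u, v, rfl, h, lt_of_le_of_ne (not_lt.1 hlt) (hne u v h).symm⟩
  constructor
  · rintro h e u v huv rfl hE
    have h1 := h u v huv
    simp only [orientedGraph, not_and] at h1
    have h2 := h1 hE
    rw [Bool.eq_iff_iff, decide_eq_true_iff, hd u v huv]
    tauto
  · intro h u v huv hadj
    have h1 := h _ u v huv rfl hadj.1
    rw [Bool.eq_iff_iff, decide_eq_true_iff, hd u v huv] at h1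
    have := hadj.2
    tauto

/-- The event that some set of at least `t` vertices, with at least `t` vertices in its complement,
has no outgoing arc. -/
def midClosed (n t : ℕ) : Set (SimpleGraph (Fin n) × (Sym2 (Fin n) → Bool)) :=
  {ω | ∃ S : Finset (Fin n), t ≤ S.card ∧ S.card + t ≤ n ∧
    ∀ u ∈ S, ∀ v ∉ S, ¬ (orientedGraph ω).Adj u v}

lemma orientedGnm_real_midClosed_le {n m : ℕ} (hm : m ≤ n.choose 2) (t : ℕ) :
    (orientedGnm n m).real (midClosed n t) ≤ ∑ k ∈ Finset.range (n + 1),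
      if t ≤ k ∧ k + t ≤ n then (n.choose k : ℝ) * slotProb (n.choose 2) m (k * (n - k)) else 0 := by
  classical
  have := isProbabilityMeasure_orientedGnm hm
  have hsub : midClosed n t ⊆ ⋃ S ∈ (Finset.univ.powerset.filter fun S : Finset (Fin n) =>
      t ≤ S.card ∧ S.card + t ≤ n), noArcs (S ×ˢ Sᶜ) := by
    rintro ω ⟨S, h1, h2, h3⟩
    simp only [Set.mem_iUnion]
    refine ⟨S, by simp [h1, h2], ?_⟩
    rintro ⟨u, v⟩ h
    rw [Finset.mem_product, Finset.mem_compl] at h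
    exact h3 u h.1 v h.2
  refine (measureReal_mono hsub (measure_ne_top _ _)).trans ((measureReal_biUnion_finset_le _ _).trans ?_)
  rw [Finset.sum_filter]
  have h2 := Finset.sum_powerset_apply_card (fun k => if t ≤ k ∧ k + t ≤ n then
    slotProb (n.choose 2) m (k * (n - k)) else 0) (x := (Finset.univ : Finset (Fin n)))
  simp only [Finset.card_univ, Fintype.card_fin, smul_ite, smul_zero, nsmul_eq_mul] at h2
  rw [← h2]
  refine Finset.sum_le_sum fun S _ => ?_
  split_ifs
  · rw [orientedGnm_real_noArcs hm, Finset.card_product, Finset.card_compl, Fintype.card_fin]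
    intro u v h h'
    simp only [Finset.mem_product, Finset.mem_compl] at h h'
    exact h.2 h'.1
  · rfl

section
variable {V : Type*} (D : V → V → Prop)

/-- At most one vertex can be reached from `v` along one arc. -/
def OutSmall (v : V) : Prop := ∃ x, ∀ w, D v w → w = x

/-- At most one vertex has an arc to `v`. -/
def InSmall (v : V) : Prop := ∃ x, ∀ w, D w v → w = x

end

/-- The event that some vertex has at most one outgoing and at most one incoming arc. -/
def lowDegree (n : ℕ) : Set (SimpleGraph (Fin n) × (Sym2 (Fin n) → Bool)) :=
  {ω | ∃ v, OutSmall (orientedGraph ω).Adj v ∧ InSmall (orientedGraph ω).Adj v}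

/-- The event that three vertices each have at most one outgoing or at most one incoming arc. -/
def threeSmall (n : ℕ) : Set (SimpleGraph (Fin n) × (Sym2 (Fin n) → Bool)) :=
  {ω | ∃ x : Fin 3 → Fin n, Function.Injective x ∧
    ∀ i, OutSmall (orientedGraph ω).Adj (x i) ∨ InSmall (orientedGraph ω).Adj (x i)}

/-- If `x` is the only possible out-neighbour of `v` and `y` the only possible in-neighbour, then
`v` has no edge to any other vertex. The factor n^3 counts the triples (v, x, y). -/
lemma orientedGnm_real_lowDegree_le {n m : ℕ} (hm : m ≤ n.choose 2) :
    (orientedGnm n m).real (lowDegree n) ≤ n ^ 3 * (1 - edgeDensity n m) ^ (n - 3) := by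
  classical
  have := isProbabilityMeasure_orientedGnm hm
  let T : Fin n × Fin n × Fin n → Finset (Sym2 (Fin n)) := fun q =>
    (({q.1, q.2.1, q.2.2} : Finset (Fin n))ᶜ).image fun w => s(q.1, w)
  have hsub : lowDegree n ⊆ ⋃ q ∈ (Finset.univ : Finset (Fin n × Fin n × Fin n)),
      noEdgesIn (T q) := by
    rintro ω ⟨v, ⟨x, hx⟩, ⟨y, hy⟩⟩
    simp only [Set.mem_iUnion]
    refine ⟨(v, x, y), Finset.mem_univ _, ?_⟩
    intro e he hE
    obtain ⟨w, hw, rfl⟩ := Finset.mem_image.1 he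
    simp only [Finset.mem_compl, Finset.mem_insert, Finset.mem_singleton, not_or] at hw
    have hadj : ω.1.Adj v w := hE
    by_cases h : (ω.2 s(v, w) = true ↔ v < w)
    · exact hw.2.1 (hx w ⟨hadj, h⟩)
    · refine hw.2.2 (hy w ⟨hadj.symm, ?_⟩)
      rw [Sym2.eq_swap]
      have := not_lt (a := v) (b := w)
      have h3 : w < v ↔ ¬ v < w := ⟨fun h => h.not_gt, fun h => lt_of_le_of_ne (not_lt.1 h) hw.1⟩
      rw [h3]
      tauto
  have hm' : (m : ℝ) ≤ n.choose 2 := by exact_mod_cast hm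
  have hp1 : edgeDensity n m ≤ 1 := div_le_one_of_le₀ hm' (by positivity)
  have hp0 : 0 ≤ edgeDensity n m := by unfold edgeDensity; positivity
  refine (measureReal_mono hsub (measure_ne_top _ _)).trans ((measureReal_biUnion_finset_le _ _).trans ?_)
  have hT : ∀ q, (orientedGnm n m).real (noEdgesIn (T q)) ≤ (1 - edgeDensity n m) ^ (n - 3) := by
    intro q
    have hTs : T q ⊆ slots n := by
      intro e he
      obtain ⟨w, hw, rfl⟩ := Finset.mem_image.1 he
      simp only [Finset.mem_compl, Finset.mem_insert, Finset.mem_singleton, not_or] at hw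
      exact mem_slots.2 (by simpa using Ne.symm hw.1)
    refine (orientedGnm_real_noEdgesIn_le hm hTs).trans ?_
    refine pow_le_pow_of_le_one (by linarith) (by linarith) ?_
    rw [Finset.card_image_of_injective _ (fun a b h => Sym2.congr_right.1 h), Finset.card_compl,
      Fintype.card_fin]
    have := Finset.card_le_three (a := q.1) (b := q.2.1) (c := q.2.2)
    omega
  refine (Finset.sum_le_sum fun q _ => hT q).trans (le_of_eq ?_)
  rw [Finset.sum_const, Finset.card_univ, Fintype.card_prod, Fintype.card_prod, Fintype.card_fin,
    nsmul_eq_mul]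
  push_cast
  ring

/-- Each of the three vertices loses all arcs in one direction, up to one exceptional neighbour.
Discarding the three vertices and their exceptions as other endpoints leaves at least 3(n-6)
forbidden arcs on distinct pairs; 8n^6 counts vertices, exceptions and directions. -/
lemma orientedGnm_real_threeSmall_le {n m : ℕ} (hm : m ≤ n.choose 2) (hn : 6 ≤ n)
    (hn' : 3 * n ≤ n.choose 2) :
    (orientedGnm n m).real (threeSmall n) ≤
      8 * n ^ 6 * slotProb (n.choose 2) m (3 * (n - 6)) := by
  classical
  have := isProbabilityMeasure_orientedGnm hm
  let W : (Fin 3 → Fin n) × (Fin 3 → Fin n) × (Fin 3 → Bool) → Finset (Fin n) := fun q =>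
    (Finset.univ.image q.1 ∪ Finset.univ.image q.2.1)ᶜ
  let F : (Fin 3 → Fin n) × (Fin 3 → Fin n) × (Fin 3 → Bool) → Fin 3 × Fin n → Fin n × Fin n :=
    fun q r => if q.2.2 r.1 = true then (q.1 r.1, r.2) else (r.2, q.1 r.1)
  let R : (Fin 3 → Fin n) × (Fin 3 → Fin n) × (Fin 3 → Bool) → Finset (Fin n × Fin n) := fun q =>
    ((Finset.univ : Finset (Fin 3)) ×ˢ W q).image (F q)
  let Q := (Finset.univ : Finset ((Fin 3 → Fin n) × (Fin 3 → Fin n) × (Fin 3 → Bool))).filter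
    fun q => Function.Injective q.1
  have hW : ∀ q w, w ∈ W q → ∀ i, w ≠ q.1 i ∧ w ≠ q.2.1 i := by
    intro q w hw i
    simp only [W, Finset.mem_compl, Finset.mem_union, Finset.mem_image, Finset.mem_univ, true_and,
      not_or, not_exists] at hw
    exact ⟨Ne.symm (hw.1 i), Ne.symm (hw.2 i)⟩
  have hsub : threeSmall n ⊆ ⋃ q ∈ Q, noArcs (R q) := by
    rintro ω ⟨x, hx, hsm⟩
    have : ∀ i, ∃ y : Fin n, ∃ t : Bool, ∀ w, (if t = true then (orientedGraph ω).Adj (x i) w else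
        (orientedGraph ω).Adj w (x i)) → w = y := by
      intro i
      rcases hsm i with ⟨y, hy⟩ | ⟨y, hy⟩
      · exact ⟨y, true, by simpa using hy⟩
      · exact ⟨y, false, by simpa using hy⟩
    choose y t hyt using this
    simp only [Set.mem_iUnion]
    refine ⟨(x, y, t), by simp [Q, hx], ?_⟩
    intro r hr hadj
    obtain ⟨⟨i, w⟩, hiw, rfl⟩ := Finset.mem_image.1 hr
    have hw := hW _ _ (Finset.mem_product.1 hiw).2 i
    refine hw.2 (hyt i w ?_)
    simp only [F] at hadj
    split_ifs with h <;> simpa [h] using hadj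
  refine (measureReal_mono hsub (measure_ne_top _ _)).trans ((measureReal_biUnion_finset_le _ _).trans ?_)
  have hT : ∀ q ∈ Q, (orientedGnm n m).real (noArcs (R q)) ≤
      slotProb (n.choose 2) m (3 * (n - 6)) := by
    intro q hq
    have hq : Function.Injective q.1 := (Finset.mem_filter.1 hq).2
    have hinj : Set.InjOn (F q) ((Finset.univ : Finset (Fin 3)) ×ˢ W q : Finset _) := by
      rintro ⟨i, w⟩ hi ⟨j, w'⟩ hj h
      have hw := hW q w (Finset.mem_product.1 hi).2
      have hw' := hW q w' (Finset.mem_product.1 hj).2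
      simp only [F] at h
      split_ifs at h <;> simp only [Prod.mk.injEq] at h
      · exact Prod.ext (hq h.1) h.2
      · exact absurd h.2 (hw j).1
      · exact absurd h.1 (hw j).1
      · exact Prod.ext (hq h.2) h.1
    have hanti : ∀ u v, (u, v) ∈ R q → (v, u) ∉ R q := by
      intro u v h h'
      obtain ⟨⟨i, w⟩, hi, h1⟩ := Finset.mem_image.1 h
      obtain ⟨⟨j, w'⟩, hj, h2⟩ := Finset.mem_image.1 h'
      have hw := hW q w (Finset.mem_product.1 hi).2
      have hw' := hW q w' (Finset.mem_product.1 hj).2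
      simp only [F] at h1 h2
      split_ifs at h1 h2 with h3 h4 h4 <;> simp only [Prod.mk.injEq] at h1 h2 <;>
        obtain ⟨rfl, rfl⟩ := h1
      · exact (hw j).1 h2.1.symm
      · have := hq h2.2
        subst this
        exact h4 h3
      · have := hq h2.1
        subst this
        exact h3 h4
      · exact (hw j).1 h2.2.symm
    rw [orientedGnm_real_noArcs hm _ hanti]
    have hcard : (R q).card = 3 * (W q).card := by
      rw [Finset.card_image_of_injOn hinj, Finset.card_product]
      simp
    have h6 : (Finset.univ.image q.1 ∪ Finset.univ.image q.2.1).card ≤ 6 := by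
      refine (Finset.card_union_le _ _).trans ?_
      have h1 := Finset.card_image_le (s := Finset.univ) (f := q.1)
      have h2 := Finset.card_image_le (s := Finset.univ) (f := q.2.1)
      simp only [Finset.card_univ, Fintype.card_fin] at h1 h2
      omega
    have hWc : (W q).card = n - (Finset.univ.image q.1 ∪ Finset.univ.image q.2.1).card := by
      rw [Finset.card_compl, Fintype.card_fin]
    obtain ⟨L, hL⟩ : ∃ L, (R q).card = 3 * (n - 6) + L := ⟨(R q).card - 3 * (n - 6), by omega⟩
    rw [hL]
    exact slotProb_antitone hm L (by omega)
  refine (Finset.sum_le_sum hT).trans ?_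
  rw [Finset.sum_const, nsmul_eq_mul]
  refine mul_le_mul_of_nonneg_right ?_ (slotProb_pos hm _).le
  have hQ : Q.card ≤ n ^ 3 * (n ^ 3 * 2 ^ 3) := by
    refine (Finset.card_filter_le _ _).trans ?_
    simp
  have : (Q.card : ℝ) ≤ n ^ 3 * (n ^ 3 * 2 ^ 3) := by exact_mod_cast hQ
  refine this.trans (le_of_eq ?_)
  ring

/-! ### Closed sets and the causes of non-reachability. -/

lemma outSmall_of_closed {V : Type*} [DecidableEq V] {D : V → V → Prop} {S : Finset V} (hirr : ∀ v, ¬ D v v)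
    (hS : ∀ u ∈ S, ∀ v ∉ S, ¬ D u v) (hc : S.card ≤ 2) {v : V} (hv : v ∈ S) : OutSmall D v := by
  have hc' : (S.erase v).card ≤ 1 := by
    rw [Finset.card_erase_of_mem hv]; omega
  have hmem : ∀ w, D v w → w ∈ S.erase v := fun w h =>
    Finset.mem_erase.2 ⟨fun h' => hirr v (h' ▸ h), by_contra fun hw => hS v hv w hw h⟩
  by_cases h : ∃ x, D v x
  · obtain ⟨x, hx⟩ := h
    exact ⟨x, fun w hw => Finset.card_le_one.1 hc' _ (hmem w hw) _ (hmem x hx)⟩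
  · exact ⟨v, fun w hw => absurd ⟨w, hw⟩ h⟩

lemma inSmall_of_closed {V : Type*} [Fintype V] [DecidableEq V] {D : V → V → Prop} {S : Finset V} (hirr : ∀ v, ¬ D v v)
    (hS : ∀ u ∈ S, ∀ v ∉ S, ¬ D u v) (hc : Sᶜ.card ≤ 2) {v : V} (hv : v ∉ S) : InSmall D v :=
  outSmall_of_closed (D := fun u v => D v u) hirr
    (fun u hu v hv => hS v (by simpa using hv) u (by simpa using hu)) hc (by simpa using hv)

lemma exists_closed_of_not_reach {V : Type*} [Fintype V] {D : V → V → Prop} {s a : V}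
    (h : ¬ Relation.ReflTransGen D s a) :
    ∃ S : Finset V, s ∈ S ∧ a ∉ S ∧ ∀ u ∈ S, ∀ v ∉ S, ¬ D u v := by
  classical
  refine ⟨Finset.univ.filter fun v => Relation.ReflTransGen D s v, ?_, by simpa using h, ?_⟩
  · simpa using Relation.ReflTransGen.refl
  · intro u hu v hv huv
    simp only [Finset.mem_filter, Finset.mem_univ, true_and] at hu hv
    exact hv (hu.tail huv)

lemma not_reach_of_closed {V : Type*} {D : V → V → Prop} {s a : V} {S : Set V} (hs : s ∈ S) (ha : a ∉ S)
    (hS : ∀ u ∈ S, ∀ v ∉ S, ¬ D u v) : ¬ Relation.ReflTransGen D s a := by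
  intro h
  have : ∀ v, Relation.ReflTransGen D s v → v ∈ S := by
    intro v hv
    induction hv with
    | refl => exact hs
    | tail _ huv ih => exact by_contra fun hv => hS _ ih _ hv huv
  exact ha (this a h)

/-- If few vertices have small degree, two failures of reachability have an obvious cause. -/
lemma not_reach_cases {V : Type*} [Fintype V] [DecidableEq V] {D : V → V → Prop} {s a b : V} (hirr : ∀ v, ¬ D v v)
    (hmid : ∀ S : Finset V, (∀ u ∈ S, ∀ v ∉ S, ¬ D u v) → S.card ≤ 2 ∨ Sᶜ.card ≤ 2)
    (hlow : ∀ v, ¬ (OutSmall D v ∧ InSmall D v))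
    (hthree : ∀ x y z, x ≠ y → x ≠ z → y ≠ z → (OutSmall D x ∨ InSmall D x) →
      (OutSmall D y ∨ InSmall D y) → ¬ (OutSmall D z ∨ InSmall D z))
    (hsa : s ≠ a) (hsb : s ≠ b)
    (h1 : ¬ Relation.ReflTransGen D s a) (h2 : ¬ Relation.ReflTransGen D b s) :
    ((∀ w, ¬ D b w) ∧ ∀ w, w ≠ b → ¬ D s w) ∨
    ((∀ w, ¬ D w a) ∧ ∀ w, ¬ D b w) ∨
    ((∀ w, ¬ D w a) ∧ ∀ w, w ≠ a → ¬ D w s) := by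
  obtain ⟨A, hsA, haA, hA⟩ := exists_closed_of_not_reach h1
  obtain ⟨B, hbB, hsB, hB⟩ := exists_closed_of_not_reach h2
  have two : ∀ x y z, x ≠ y → (OutSmall D x ∨ InSmall D x) → (OutSmall D y ∨ InSmall D y) →
      (OutSmall D z ∨ InSmall D z) → z = x ∨ z = y := by
    intro x y z hxy hx hy hz
    by_contra! h
    exact hthree x y z hxy h.1.symm h.2.symm hx hy hz
  -- Members of a closed set of size at most 2 are `OutSmall`; the vertices outside one with
  -- complement of size at most 2 are `InSmall`. Only two vertices can be small, which confines the
  -- small sets to a known pair.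
  rcases hmid A hA with cA | cA <;> rcases hmid B hB with cB | cB
  · have oA := fun v hv => outSmall_of_closed (v := v) hirr hA cA hv
    have oB := fun v hv => outSmall_of_closed (v := v) hirr hB cB hv
    have key := fun z => two s b z hsb (.inl (oA s hsA)) (.inl (oB b hbB))
    refine .inl ⟨fun w hw => ?_, fun w hwb hw => ?_⟩
    · have hwB : w ∈ B := by_contra fun h => hB b hbB w h hw
      rcases key w (.inl (oB w hwB)) with rfl | rfl
      · exact hsB hwB
      · exact hirr _ hw
    · have hwA : w ∈ A := by_contra fun h => hA s hsA w h hw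
      rcases key w (.inl (oA w hwA)) with rfl | rfl
      · exact hirr _ hw
      · exact hwb rfl
  -- Here `s` lies in the small set `A` and in the small complement of `B`.
  · exact absurd ⟨outSmall_of_closed hirr hA cA hsA, inSmall_of_closed hirr hB cB hsB⟩ (hlow s)
  · have iA := fun v hv => inSmall_of_closed (v := v) hirr hA cA hv
    have oB := fun v hv => outSmall_of_closed (v := v) hirr hB cB hv
    have hab : a ≠ b := by
      rintro rfl
      exact hlow a ⟨oB a hbB, iA a haA⟩
    have key := fun z => two a b z hab (.inr (iA a haA)) (.inl (oB b hbB))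
    refine .inr (.inl ⟨fun w hw => ?_, fun w hw => ?_⟩)
    · have hwA : w ∉ A := fun h => hA w h a haA hw
      rcases key w (.inr (iA w hwA)) with rfl | rfl
      · exact hirr _ hw
      · exact hlow w ⟨oB w hbB, iA w hwA⟩
    · have hwB : w ∈ B := by_contra fun h => hB b hbB w h hw
      rcases key w (.inl (oB w hwB)) with rfl | rfl
      · exact hlow w ⟨oB w hwB, iA w haA⟩
      · exact hirr _ hw
  · have iA := fun v hv => inSmall_of_closed (v := v) hirr hA cA hv
    have iB := fun v hv => inSmall_of_closed (v := v) hirr hB cB hv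
    have key := fun z => two a s z hsa.symm (.inr (iA a haA)) (.inr (iB s hsB))
    refine .inr (.inr ⟨fun w hw => ?_, fun w hwa hw => ?_⟩)
    · have hwA : w ∉ A := fun h => hA w h a haA hw
      rcases key w (.inr (iA w hwA)) with rfl | rfl
      · exact hirr _ hw
      · exact hwA hsA
    · have hwB : w ∉ B := fun h => hB w h s hsB hw
      rcases key w (.inr (iB w hwB)) with rfl | rfl
      · exact hwa rfl
      · exact hirr _ hw

/-! ### The main scenarios and inclusion-exclusion. -/

section
variable {n m : ℕ}

/-- The arcs from `b`, and the arcs from `s` except to `b`. -/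
def outOutArcs (b s : Fin n) : Finset (Fin n × Fin n) :=
  (Finset.univ.erase b).image (fun w => (b, w)) ∪
    ((Finset.univ.erase b).erase s).image (fun w => (s, w))

/-- The arcs to `a`, and the arcs from `b`. -/
def inOutArcs (a b : Fin n) : Finset (Fin n × Fin n) :=
  (Finset.univ.erase a).image (fun w => (w, a)) ∪
    ((Finset.univ.erase a).erase b).image (fun w => (b, w))

/-- The arcs to `a`, and the arcs to `s` except from `a`. -/
def inInArcs (a s : Fin n) : Finset (Fin n × Fin n) :=
  (Finset.univ.erase a).image (fun w => (w, a)) ∪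
    ((Finset.univ.erase a).erase s).image (fun w => (w, s))

/-- The stars contribute n-1 and n-2 arcs: the second omits the arc on the pair {u, v}. -/
lemma card_union_star {f g : Fin n → Fin n × Fin n} (hf : f.Injective) (hg : g.Injective)
    {u v : Fin n} (huv : u ≠ v)
    (h : ∀ w w', w' ≠ u → w' ≠ v → f w ≠ g w') :
    ((Finset.univ.erase u).image f ∪ ((Finset.univ.erase u).erase v).image g).card = 2 * n - 3 := by
  have c1 : (Finset.univ.erase u).card = n - 1 := by
    rw [Finset.card_erase_of_mem (Finset.mem_univ _), Finset.card_univ, Fintype.card_fin]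
  have c2 : ((Finset.univ.erase u).erase v).card = n - 1 - 1 := by
    rw [Finset.card_erase_of_mem (Finset.mem_erase.2 ⟨huv.symm, Finset.mem_univ _⟩), c1]
  rw [Finset.card_union_of_disjoint, Finset.card_image_of_injective _ hf,
    Finset.card_image_of_injective _ hg, c1, c2]
  · have := u.2
    have := v.2
    have : (u : ℕ) ≠ v := fun h => huv (Fin.ext h)
    omega
  · rw [Finset.disjoint_left]
    intro q hq hq'
    obtain ⟨w, -, rfl⟩ := Finset.mem_image.1 hq
    obtain ⟨w', hw', h'⟩ := Finset.mem_image.1 hq'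
    simp only [Finset.mem_erase, Finset.mem_univ, and_true] at hw'
    exact h w w' hw'.2 hw'.1 h'.symm

lemma mem_outOutArcs {b s : Fin n} {q : Fin n × Fin n} : q ∈ outOutArcs b s ↔
    (q.1 = b ∧ q.2 ≠ b) ∨ (q.1 = s ∧ q.2 ≠ s ∧ q.2 ≠ b) := by
  obtain ⟨u, v⟩ := q
  simp only [outOutArcs, Finset.mem_union, Finset.mem_image, Finset.mem_erase, Finset.mem_univ,
    Prod.mk.injEq]
  aesop

lemma mem_inOutArcs {a b : Fin n} {q : Fin n × Fin n} : q ∈ inOutArcs a b ↔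
    (q.2 = a ∧ q.1 ≠ a) ∨ (q.1 = b ∧ q.2 ≠ b ∧ q.2 ≠ a) := by
  obtain ⟨u, v⟩ := q
  simp only [inOutArcs, Finset.mem_union, Finset.mem_image, Finset.mem_erase, Finset.mem_univ,
    Prod.mk.injEq]
  aesop

lemma mem_inInArcs {a s : Fin n} {q : Fin n × Fin n} : q ∈ inInArcs a s ↔
    (q.2 = a ∧ q.1 ≠ a) ∨ (q.2 = s ∧ q.1 ≠ s ∧ q.1 ≠ a) := by
  obtain ⟨u, v⟩ := q
  simp only [inInArcs, Finset.mem_union, Finset.mem_image, Finset.mem_erase, Finset.mem_univ,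
    Prod.mk.injEq]
  aesop

lemma real_outOutArcs (hm : m ≤ n.choose 2) {b s : Fin n} (h : b ≠ s) :
    (orientedGnm n m).real (noArcs (outOutArcs b s)) = slotProb (n.choose 2) m (2 * n - 3) := by
  rw [orientedGnm_real_noArcs hm, outOutArcs, card_union_star (Prod.mk_right_injective b)
    (Prod.mk_right_injective s) h]
  · intro w w' _ _ h'
    exact h (Prod.mk.inj h').1
  · intro u v h1 h2
    simp only [mem_outOutArcs] at h1 h2
    aesop

lemma real_inOutArcs (hm : m ≤ n.choose 2) {a b : Fin n} (h : a ≠ b) :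
    (orientedGnm n m).real (noArcs (inOutArcs a b)) = slotProb (n.choose 2) m (2 * n - 3) := by
  rw [orientedGnm_real_noArcs hm, inOutArcs, card_union_star (Prod.mk_left_injective a)
    (Prod.mk_right_injective b) h]
  · intro w w' h1 _ h'
    exact h1 (Prod.mk.inj h').2.symm
  · intro u v h1 h2
    simp only [mem_inOutArcs] at h1 h2
    aesop

lemma real_inInArcs (hm : m ≤ n.choose 2) {a s : Fin n} (h : a ≠ s) :
    (orientedGnm n m).real (noArcs (inInArcs a s)) = slotProb (n.choose 2) m (2 * n - 3) := by
  rw [orientedGnm_real_noArcs hm, inInArcs, card_union_star (Prod.mk_left_injective a)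
    (Prod.mk_left_injective s) h]
  · intro w w' _ _ h'
    exact h (Prod.mk.inj h').2
  · intro u v h1 h2
    simp only [mem_inInArcs] at h1 h2
    aesop

lemma mem_noArcs_outOut {b s : Fin n} {ω : SimpleGraph (Fin n) × (Sym2 (Fin n) → Bool)} :
    ω ∈ noArcs (outOutArcs b s) ↔
      (∀ w, ¬ (orientedGraph ω).Adj b w) ∧ ∀ w, w ≠ b → ¬ (orientedGraph ω).Adj s w := by
  have := orientedGraph_irrefl ω
  simp only [noArcs, Set.mem_ofPred_eq, mem_outOutArcs, Prod.forall]
  grind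

lemma mem_noArcs_inOut {a b : Fin n} {ω : SimpleGraph (Fin n) × (Sym2 (Fin n) → Bool)} :
    ω ∈ noArcs (inOutArcs a b) ↔
      (∀ w, ¬ (orientedGraph ω).Adj w a) ∧ ∀ w, ¬ (orientedGraph ω).Adj b w := by
  have := orientedGraph_irrefl ω
  simp only [noArcs, Set.mem_ofPred_eq, mem_inOutArcs, Prod.forall]
  grind

lemma mem_noArcs_inIn {a s : Fin n} {ω : SimpleGraph (Fin n) × (Sym2 (Fin n) → Bool)} :
    ω ∈ noArcs (inInArcs a s) ↔
      (∀ w, ¬ (orientedGraph ω).Adj w a) ∧ ∀ w, w ≠ a → ¬ (orientedGraph ω).Adj w s := by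
  have := orientedGraph_irrefl ω
  simp only [noArcs, Set.mem_ofPred_eq, mem_inInArcs, Prod.forall]
  grind

lemma mem_threeSmall {x y z : Fin n} {ω : SimpleGraph (Fin n) × (Sym2 (Fin n) → Bool)}
    (hxy : x ≠ y) (hxz : x ≠ z) (hyz : y ≠ z)
    (hx : OutSmall (orientedGraph ω).Adj x ∨ InSmall (orientedGraph ω).Adj x)
    (hy : OutSmall (orientedGraph ω).Adj y ∨ InSmall (orientedGraph ω).Adj y)
    (hz : OutSmall (orientedGraph ω).Adj z ∨ InSmall (orientedGraph ω).Adj z) :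
    ω ∈ threeSmall n := by
  refine ⟨![x, y, z], ?_, ?_⟩
  · intro i j h
    fin_cases i <;> fin_cases j <;> simp_all
  · intro i
    fin_cases i <;> simpa

/-- The atypical configurations. -/
def atypical (n : ℕ) : Set (SimpleGraph (Fin n) × (Sym2 (Fin n) → Bool)) :=
  midClosed n 3 ∪ lowDegree n ∪ threeSmall n

lemma notReach_inter_subset {s a b : Fin n} (hsa : s ≠ a) (hsb : s ≠ b) :
    notReach s a ∩ notReach b s ⊆ noArcs (outOutArcs b s) ∪ noArcs (inOutArcs a b) ∪
      noArcs (inInArcs a s) ∪ atypical n := by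
  rintro ω ⟨h1, h2⟩
  by_cases hat : ω ∈ atypical n
  · exact .inr hat
  simp only [atypical, Set.mem_union, not_or] at hat
  have key := not_reach_cases (D := (orientedGraph ω).Adj) (orientedGraph_irrefl ω) ?_ ?_ ?_
    hsa hsb h1 h2
  · rw [← mem_noArcs_outOut, ← mem_noArcs_inOut, ← mem_noArcs_inIn] at key
    rcases key with h | h | h
    · exact .inl (.inl (.inl h))
    · exact .inl (.inl (.inr h))
    · exact .inl (.inr h)
  · intro S hS
    by_contra! hc
    have h3 := Finset.card_compl_add_card S
    rw [Fintype.card_fin] at h3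
    exact hat.1.1 ⟨S, by omega, by omega, hS⟩
  · exact fun v hv => hat.1.2 ⟨v, hv⟩
  · exact fun x y z hxy hxz hyz hx hy hz => hat.2 (mem_threeSmall hxy hxz hyz hx hy hz)

lemma subset_notReach_inter {s a b : Fin n} (hsa : s ≠ a) (hsb : s ≠ b) (hab : a ≠ b) :
    noArcs (outOutArcs b s) ∪ noArcs (inOutArcs a b) ∪ noArcs (inInArcs a s) ⊆
      notReach s a ∩ notReach b s := by
  rintro ω ((h | h) | h)
  · rw [mem_noArcs_outOut] at h
    refine ⟨not_reach_of_closed (S := {s, b}) (by simp) (by simp [hsa.symm, hab]) ?_,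
      not_reach_of_closed (S := {b}) (by simp) (by simpa using hsb) ?_⟩
    · rintro u (rfl | rfl) v hv
      · exact h.2 v fun h' => hv (.inr h')
      · exact h.1 v
    · rintro u rfl v hv
      exact h.1 v
  · rw [mem_noArcs_inOut] at h
    refine ⟨not_reach_of_closed (S := {a}ᶜ) (by simpa using hsa) (by simp) ?_,
      not_reach_of_closed (S := {b}) (by simp) (by simpa using hsb) ?_⟩
    · intro u _ v hv
      rw [Set.notMem_compl_iff] at hv
      rw [Set.mem_singleton_iff.1 hv]
      exact h.1 u
    · rintro u rfl v hv
      exact h.2 v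
  · rw [mem_noArcs_inIn] at h
    refine ⟨not_reach_of_closed (S := {a}ᶜ) (by simpa using hsa) (by simp) ?_,
      not_reach_of_closed (S := {a, s}ᶜ) (by simp [hab.symm, hsb.symm]) (by simp) ?_⟩
    · intro u _ v hv
      rw [Set.notMem_compl_iff] at hv
      rw [Set.mem_singleton_iff.1 hv]
      exact h.1 u
    · intro u hu v hv
      rw [Set.notMem_compl_iff] at hv
      rcases hv with rfl | rfl
      · exact h.1 u
      · exact h.2 u fun h' => hu (.inl h')

/-- Two scenarios at once make either `s`, `a`, `b` all small, or `s` small in both directions. -/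
lemma noArcs_inter_subset {s a b : Fin n} (hsa : s ≠ a) (hsb : s ≠ b) (hab : a ≠ b) :
    noArcs (outOutArcs b s) ∩ noArcs (inOutArcs a b) ⊆ atypical n ∧
    noArcs (outOutArcs b s) ∩ noArcs (inInArcs a s) ⊆ atypical n ∧
    noArcs (inOutArcs a b) ∩ noArcs (inInArcs a s) ⊆ atypical n := by
  refine ⟨?_, ?_, ?_⟩ <;> rintro ω ⟨h1, h2⟩
  · rw [mem_noArcs_outOut] at h1
    rw [mem_noArcs_inOut] at h2
    exact .inr (mem_threeSmall hsa hsb hab (.inl ⟨b, fun w hw => by_contra fun h => h1.2 w h hw⟩)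
      (.inr ⟨a, fun w hw => absurd hw (h2.1 w)⟩) (.inl ⟨b, fun w hw => absurd hw (h1.1 w)⟩))
  · rw [mem_noArcs_outOut] at h1
    rw [mem_noArcs_inIn] at h2
    exact .inl (.inr ⟨s, ⟨b, fun w hw => by_contra fun h => h1.2 w h hw⟩,
      ⟨a, fun w hw => by_contra fun h => h2.2 w h hw⟩⟩)
  · rw [mem_noArcs_inOut] at h1
    rw [mem_noArcs_inIn] at h2
    exact .inr (mem_threeSmall hsa hsb hab (.inr ⟨a, fun w hw => by_contra fun h => h2.2 w h hw⟩)
      (.inr ⟨a, fun w hw => absurd hw (h1.1 w)⟩) (.inl ⟨b, fun w hw => absurd hw (h1.2 w)⟩))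

lemma abs_real_notReach_inter_sub_le (hm : m ≤ n.choose 2) {s a b : Fin n} (hsa : s ≠ a)
    (hsb : s ≠ b) (hab : a ≠ b) :
    |(orientedGnm n m).real (notReach s a ∩ notReach b s) -
      3 * slotProb (n.choose 2) m (2 * n - 3)| ≤ 3 * (orientedGnm n m).real (atypical n) := by
  have := isProbabilityMeasure_orientedGnm hm
  have hmeas : ∀ A : Set (SimpleGraph (Fin n) × (Sym2 (Fin n) → Bool)), MeasurableSet A :=
    fun A => (Set.toFinite A).measurableSet
  have e1 := real_outOutArcs hm hsb.symm
  have e2 := real_inOutArcs hm hab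
  have e3 := real_inInArcs hm hsa.symm
  have up := measureReal_mono (μ := orientedGnm n m) (notReach_inter_subset hsa hsb)
    (measure_ne_top _ _)
  have lo := measureReal_mono (μ := orientedGnm n m) (subset_notReach_inter hsa hsb hab)
    (measure_ne_top _ _)
  obtain ⟨i1, i2, i3⟩ := noArcs_inter_subset hsa hsb hab
  set E1 := noArcs (outOutArcs b s)
  set E2 := noArcs (inOutArcs a b)
  set E3 := noArcs (inInArcs a s)
  set P := orientedGnm n m
  have j1 := measureReal_mono (μ := P) i1 (measure_ne_top _ _)
  have j2 := measureReal_mono (μ := P) (Set.union_subset i2 i3) (measure_ne_top _ _)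
  rw [← Set.union_inter_distrib_right] at j2
  have k1 := measureReal_union_add_inter (μ := P) (s := E1) (t := E2) (hmeas _)
  have k2 := measureReal_union_add_inter (μ := P) (s := E1 ∪ E2) (t := E3) (hmeas _)
  have k3 := measureReal_union_le (μ := P) (E1 ∪ E2 ∪ E3) (atypical n)
  have n1 := measureReal_nonneg (μ := P) (s := E1 ∩ E2)
  have n2 := measureReal_nonneg (μ := P) (s := (E1 ∪ E2) ∩ E3)
  have n3 := measureReal_nonneg (μ := P) (s := atypical n)
  rw [abs_le]
  constructor <;> linarith

/-- The main causes are a closed set {s} and a closed complement of {a}; all others are in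
`midClosed n 2`. Their overlap forbids 2n-3 arcs, which accounts for the second error term. -/
lemma abs_real_notReach_sub_le (hm : m ≤ n.choose 2) {s a : Fin n} (hsa : s ≠ a) :
    |(orientedGnm n m).real (notReach s a) - 2 * slotProb (n.choose 2) m (n - 1)| ≤
      (orientedGnm n m).real (midClosed n 2) + slotProb (n.choose 2) m (2 * n - 3) := by
  have := isProbabilityMeasure_orientedGnm hm
  have hmeas : ∀ A : Set (SimpleGraph (Fin n) × (Sym2 (Fin n) → Bool)), MeasurableSet A :=
    fun A => (Set.toFinite A).measurableSet
  let R1 := (Finset.univ.erase s).image fun w => (s, w)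
  let R2 := (Finset.univ.erase a).image fun w => (w, a)
  have hR1 : ∀ ω, ω ∈ noArcs R1 ↔ ∀ w, ¬ (orientedGraph ω).Adj s w := by
    intro ω
    have := orientedGraph_irrefl ω
    simp only [noArcs, R1, Set.mem_ofPred_eq, Finset.mem_image, Finset.mem_erase, Prod.forall,
      Prod.mk.injEq, Finset.mem_univ, and_true]
    grind
  have hR2 : ∀ ω, ω ∈ noArcs R2 ↔ ∀ w, ¬ (orientedGraph ω).Adj w a := by
    intro ω
    have := orientedGraph_irrefl ω
    simp only [noArcs, R2, Set.mem_ofPred_eq, Finset.mem_image, Finset.mem_erase, Prod.forall,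
      Prod.mk.injEq, Finset.mem_univ, and_true]
    grind
  have e1 : (orientedGnm n m).real (noArcs R1) = slotProb (n.choose 2) m (n - 1) := by
    rw [orientedGnm_real_noArcs hm, Finset.card_image_of_injective _ (Prod.mk_right_injective s),
      Finset.card_erase_of_mem (Finset.mem_univ _), Finset.card_univ, Fintype.card_fin]
    intro u v h1 h2
    simp only [R1, Finset.mem_image, Finset.mem_erase, Prod.mk.injEq, Finset.mem_univ,
      and_true] at h1 h2
    grind
  have e2 : (orientedGnm n m).real (noArcs R2) = slotProb (n.choose 2) m (n - 1) := by
    rw [orientedGnm_real_noArcs hm, Finset.card_image_of_injective _ (Prod.mk_left_injective a),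
      Finset.card_erase_of_mem (Finset.mem_univ _), Finset.card_univ, Fintype.card_fin]
    intro u v h1 h2
    simp only [R2, Finset.mem_image, Finset.mem_erase, Prod.mk.injEq, Finset.mem_univ,
      and_true] at h1 h2
    grind
  have e3 := real_inOutArcs hm hsa.symm
  have up : notReach s a ⊆ noArcs R1 ∪ noArcs R2 ∪ midClosed n 2 := by
    intro ω h
    obtain ⟨S, hs, ha, hS⟩ := exists_closed_of_not_reach h
    have hirr := orientedGraph_irrefl ω
    by_cases c1 : S.card ≤ 1
    · refine .inl (.inl ((hR1 ω).2 fun w hw => ?_))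
      have hwS : w ∈ S := by_contra fun h => hS s hs w h hw
      exact hirr s (Finset.card_le_one.1 c1 _ hwS _ hs ▸ hw)
    by_cases c2 : Sᶜ.card ≤ 1
    · refine .inl (.inr ((hR2 ω).2 fun w hw => ?_))
      have hwS : w ∉ S := fun h => hS w h a ha hw
      exact hirr a (Finset.card_le_one.1 c2 w (by simpa using hwS) a (by simpa using ha) ▸ hw)
    have h3 := Finset.card_compl_add_card S
    rw [Fintype.card_fin] at h3
    exact .inr ⟨S, by omega, by omega, hS⟩
  have lo : noArcs R1 ∪ noArcs R2 ⊆ notReach s a := by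
    rintro ω (h | h)
    · rw [hR1] at h
      refine not_reach_of_closed (S := {s}) (by simp) (by simpa using hsa.symm) ?_
      rintro u rfl v _
      exact h v
    · rw [hR2] at h
      refine not_reach_of_closed (S := {a}ᶜ) (by simpa using hsa) (by simp) ?_
      intro u _ v hv
      rw [Set.notMem_compl_iff] at hv
      rw [Set.mem_singleton_iff.1 hv]
      exact h u
  have hint : noArcs R1 ∩ noArcs R2 ⊆ noArcs (inOutArcs a s) := by
    rintro ω ⟨h1, h2⟩
    exact mem_noArcs_inOut.2 ⟨(hR2 ω).1 h2, (hR1 ω).1 h1⟩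
  set P := orientedGnm n m
  have j0 := measureReal_mono (μ := P) up (measure_ne_top _ _)
  have j1 := measureReal_mono (μ := P) lo (measure_ne_top _ _)
  have j2 := measureReal_mono (μ := P) hint (measure_ne_top _ _)
  have k1 := measureReal_union_add_inter (μ := P) (s := noArcs R1) (t := noArcs R2) (hmeas _)
  have k3 := measureReal_union_le (μ := P) (noArcs R1 ∪ noArcs R2) (midClosed n 2)
  have n1 := measureReal_nonneg (μ := P) (s := noArcs R1 ∩ noArcs R2)
  have n2 := measureReal_nonneg (μ := P) (s := midClosed n 2)
  rw [abs_le]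
  constructor <;> linarith

end

/-! ### Exponential smallness of the error terms. -/

lemma tendsto_pow_mul_pow_div {θ : ℝ} (h0 : 0 ≤ θ) (h1 : θ < 1) (d k : ℕ) (hk : 0 < k) :
    Tendsto (fun n : ℕ => (n : ℝ) ^ d * θ ^ (n / k)) atTop (𝓝 0) := by
  have h := (tendsto_pow_const_mul_const_pow_of_abs_lt_one d
    (by rwa [abs_of_nonneg h0] : |θ| < 1)).comp (Nat.tendsto_div_const_atTop hk.ne')
  have h' := h.const_mul ((2 * k : ℝ) ^ d)
  rw [mul_zero] at h'
  refine squeeze_zero' (.of_forall fun n => by positivity) ?_ h'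
  filter_upwards [eventually_ge_atTop k] with n hn
  have h2 : n ≤ 2 * k * (n / k) := by
    have e1 := Nat.div_add_mod n k
    have e2 := Nat.mod_lt n hk
    have e3 : k ≤ k * (n / k) := Nat.le_mul_of_pos_right _ (Nat.div_pos hn hk)
    nlinarith
  have h3 : (n : ℝ) ≤ 2 * k * (n / k : ℕ) := by exact_mod_cast h2
  simp only [Function.comp_apply]
  rw [← mul_assoc, ← mul_pow]
  gcongr

section
variable {n m : ℕ} {p : ℝ}

/-- From N ≥ n^2/4 and K ≤ 2n comes K^3/N^2 ≤ 128/n, and 24 + 16·128 ≤ 3000. The bound n ≥ 17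
ensures 4K ≤ 8n ≤ N. -/
lemma slotProb_choose_two_bounds (hn : 17 ≤ n) (hm : m ≤ n.choose 2) (hp : p = edgeDensity n m)
    {K : ℕ} {L : ℝ} (hK : K ≤ 2 * n)
    (hL : |(K : ℝ) * (K - 1) / (2 * n.choose 2) - L| ≤ 24 / n) :
    (1 - p / 2) ^ K * Real.exp (-(L * tiltCoeff p)) * Real.exp (-(3000 / n)) ≤
        slotProb (n.choose 2) m K ∧
      slotProb (n.choose 2) m K ≤
        (1 - p / 2) ^ K * Real.exp (-(L * tiltCoeff p)) * Real.exp (3000 / n) := by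
  have hn' : (17 : ℝ) ≤ n := by exact_mod_cast hn
  have hn0 : (0 : ℝ) < n := by linarith
  have hNr : (n.choose 2 : ℝ) = n * (n - 1) / 2 := Nat.cast_choose_two ℝ n
  have hN4 : (n : ℝ) ^ 2 / 4 ≤ n.choose 2 := by rw [hNr]; nlinarith
  have hN0 : (0 : ℝ) < n.choose 2 := lt_of_lt_of_le (by positivity) hN4
  have hp0 : 0 ≤ p := by rw [hp, edgeDensity]; positivity
  have hp1 : p ≤ 1 := by
    rw [hp]; exact div_le_one_of_le₀ (by exact_mod_cast hm) (by positivity)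
  have hK' : (K : ℝ) ≤ 2 * n := by exact_mod_cast hK
  have h4K : 4 * K ≤ n.choose 2 := by
    have : (4 * K : ℝ) ≤ n.choose 2 := by rw [hNr]; nlinarith
    exact_mod_cast this
  obtain ⟨h1, h2⟩ := slotProb_bounds hm (show p = (m : ℝ) / (n.choose 2 : ℕ) from hp)
    (by exact_mod_cast hN0) h4K
  have hg0 := tiltCoeff_nonneg hp0 hp1
  have hg1 := tiltCoeff_le_one hp1
  set g := tiltCoeff p
  set A := (K : ℝ) * (K - 1) / (2 * n.choose 2)
  have hB : (K : ℝ) ^ 3 / (n.choose 2 : ℝ) ^ 2 ≤ 128 / n := by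
    have : (2 * (n : ℝ)) ^ 3 / ((n : ℝ) ^ 2 / 4) ^ 2 = 128 / n := by
      field_simp
      norm_num
    rw [← this]
    gcongr
  have hgA : |g * (A - L)| ≤ 24 / n := by
    rw [abs_mul, abs_of_nonneg hg0]
    exact (mul_le_of_le_one_left (abs_nonneg _) hg1).trans hL
  have h3 : (24 : ℝ) / n + 16 * (128 / n) ≤ 3000 / n := by
    rw [mul_div_assoc', ← add_div]
    gcongr
    norm_num
  rw [abs_le] at hgA
  have hx : 0 ≤ (1 - p / 2) ^ K := pow_nonneg (by linarith) _
  constructor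
  · refine le_trans ?_ h1
    rw [mul_assoc, ← Real.exp_add]
    exact mul_le_mul_of_nonneg_left (Real.exp_le_exp.2 (by linarith)) hx
  · refine h2.trans ?_
    rw [mul_assoc _ _ (Real.exp (3000 / n)), ← Real.exp_add]
    exact mul_le_mul_of_nonneg_left (Real.exp_le_exp.2 (by linarith)) hx

lemma abs_pred_sub_one_le (hn : 17 ≤ n) :
    |((n - 1 : ℕ) : ℝ) * ((n - 1 : ℕ) - 1) / (2 * n.choose 2) - 1| ≤ 24 / n := by
  have hn' : (17 : ℝ) ≤ n := by exact_mod_cast hn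
  have h1 : (n : ℝ) - 1 ≠ 0 := by linarith
  rw [Nat.cast_choose_two, Nat.cast_sub (by omega)]
  have : ((n : ℝ) - (1 : ℕ)) * (n - (1 : ℕ) - 1) / (2 * (n * (n - 1) / 2)) - 1 = -(2 / n) := by
    push_cast
    field_simp
    ring
  rw [this, abs_neg, abs_of_nonneg (by positivity)]
  gcongr
  norm_num

lemma abs_two_mul_sub_four_le (hn : 17 ≤ n) :
    |((2 * n - 3 : ℕ) : ℝ) * ((2 * n - 3 : ℕ) - 1) / (2 * n.choose 2) - 4| ≤ 24 / n := by
  have hn' : (17 : ℝ) ≤ n := by exact_mod_cast hn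
  have h1 : (0 : ℝ) < n - 1 := by linarith
  rw [Nat.cast_choose_two, Nat.cast_sub (by omega)]
  have : (((2 * n : ℕ) : ℝ) - (3 : ℕ)) * ((2 * n : ℕ) - (3 : ℕ) - 1) / (2 * (n * (n - 1) / 2)) - 4 =
      -((10 * n - 12) / (n - 1) / n) := by
    push_cast
    field_simp
    ring
  rw [this, abs_neg, abs_of_nonneg]
  · gcongr
    rw [div_le_iff₀ h1]
    linarith
  · apply div_nonneg (div_nonneg _ h1.le) <;> linarith

lemma mul_sub_le_choose_two {k : ℕ} (hn : 2 ≤ n) (hk : k ≤ n) : k * (n - k) ≤ n.choose 2 := by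
  have hn' : (2 : ℝ) ≤ n := by exact_mod_cast hn
  have : (k * (n - k : ℕ) : ℝ) ≤ n.choose 2 := by
    rw [Nat.cast_choose_two, Nat.cast_sub hk]
    nlinarith [sq_nonneg ((n : ℝ) - 2 * k)]
  exact_mod_cast this

/-- Here `l` is the size of the smaller side, so k(n-k) ≥ ln/2. A quarter of these arcs, at least
l(n/8), pays for the binomial coefficient, bounded by n^l; the other three quarters still cover `K`.
-/
lemma midClosed_term_le {θ : ℝ} (hn : 2 ≤ n) (hm : m ≤ n.choose 2)
    (hθ0 : 0 ≤ θ) (hθ1 : θ ≤ 1) (hxθ : 1 - edgeDensity n m / 2 ≤ θ) (hη : n * θ ^ (n / 8) ≤ 1)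
    {k l K : ℕ} (hl : 1 ≤ l) (hln : 2 * l ≤ n) (hkl : k * (n - k) = l * (n - l))
    (hc : n.choose k = n.choose l) (hK : 4 * K ≤ 3 * (k * (n - k))) (hk : k ≤ n) :
    (n.choose k : ℝ) * slotProb (n.choose 2) m (k * (n - k)) ≤
      n * θ ^ (n / 8) * slotProb (n.choose 2) m K := by
  have hkN := mul_sub_le_choose_two hn hk
  obtain ⟨d, hd⟩ : ∃ d, k * (n - k) = K + d := ⟨k * (n - k) - K, by omega⟩
  have hdl : l * (n / 8) ≤ d := by
    have h1 : l * (n / 8) * 8 ≤ l * n := by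
      rw [mul_assoc]; exact Nat.mul_le_mul_left _ (Nat.div_mul_le_self n 8)
    have h2 : l * n ≤ 2 * (l * (n - l)) := by
      rw [mul_left_comm]
      exact Nat.mul_le_mul_left _ (by omega)
    omega
  have hp1 : edgeDensity n m ≤ 1 := div_le_one_of_le₀ (by exact_mod_cast hm) (by positivity)
  have h1 := slotProb_add_le (K := K) hm d (by omega)
  change _ ≤ (1 - edgeDensity n m / 2) ^ d * _ at h1
  have hf := slotProb_pos hm K
  have h2 : (1 - edgeDensity n m / 2) ^ d ≤ θ ^ (l * (n / 8)) :=
    (pow_le_pow_left₀ (by linarith) hxθ d).trans (pow_le_pow_of_le_one hθ0 hθ1 hdl)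
  have h3 : (n.choose k : ℝ) ≤ (n : ℝ) ^ l := by
    rw [hc]; exact_mod_cast Nat.choose_le_pow n l
  have h4 : (n : ℝ) ^ l * θ ^ (l * (n / 8)) ≤ n * θ ^ (n / 8) := by
    rw [mul_comm l, pow_mul, ← mul_pow]
    exact pow_le_of_le_one (by positivity) hη (by omega)
  rw [hd]
  calc (n.choose k : ℝ) * slotProb (n.choose 2) m (K + d)
      ≤ (n : ℝ) ^ l * (θ ^ (l * (n / 8)) * slotProb (n.choose 2) m K) := by
        refine mul_le_mul h3 (h1.trans (mul_le_mul_of_nonneg_right h2 hf.le))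
          (slotProb_pos hm _).le (by positivity)
    _ ≤ _ := by
        rw [← mul_assoc]
        exact mul_le_mul_of_nonneg_right h4 hf.le

lemma real_midClosed_le {θ : ℝ} (hn : 2 ≤ n) (hm : m ≤ n.choose 2)
    (hθ0 : 0 ≤ θ) (hθ1 : θ ≤ 1) (hxθ : 1 - edgeDensity n m / 2 ≤ θ) (hη : n * θ ^ (n / 8) ≤ 1)
    {t K : ℕ} (ht : 1 ≤ t) (hK : ∀ k, t ≤ k → k + t ≤ n → 4 * K ≤ 3 * (k * (n - k))) :
    (orientedGnm n m).real (midClosed n t) ≤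
      (n + 1) * (n * θ ^ (n / 8) * slotProb (n.choose 2) m K) := by
  refine (orientedGnm_real_midClosed_le hm t).trans ?_
  have hf := slotProb_pos hm K
  have : ∀ k ∈ Finset.range (n + 1), (if t ≤ k ∧ k + t ≤ n then
      (n.choose k : ℝ) * slotProb (n.choose 2) m (k * (n - k)) else 0) ≤
      n * θ ^ (n / 8) * slotProb (n.choose 2) m K := by
    intro k _
    split_ifs with h
    · rcases le_total (2 * k) n with h2 | h2
      · exact midClosed_term_le hn hm hθ0 hθ1 hxθ hη (l := k) (by omega) h2 rfl rfl
          (hK k h.1 h.2) (by omega)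
      · have hk : k ≤ n := by omega
        refine midClosed_term_le hn hm hθ0 hθ1 hxθ hη (l := n - k) (by omega) (by omega) ?_
          (Nat.choose_symm hk).symm (hK k h.1 h.2) hk
        rw [Nat.sub_sub_self hk, mul_comm]
    · positivity
  refine (Finset.sum_le_card_nsmul _ _ _ this).trans (le_of_eq ?_)
  rw [Finset.card_range, nsmul_eq_mul]
  push_cast
  ring

lemma mul_sub_ge {t k : ℕ} (h1 : t ≤ k) (h2 : k + t ≤ n) : t * (n - t) ≤ k * (n - k) := by
  obtain ⟨i, rfl⟩ := Nat.exists_eq_add_of_le h1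
  obtain ⟨j, rfl⟩ := Nat.exists_eq_add_of_le h2
  rw [show t + i + t + j - t = t + i + j by omega, show t + i + t + j - (t + i) = t + j by omega]
  nlinarith [Nat.zero_le (i * j)]

/-- The error terms are exponentially small compared with the main terms. -/
lemma real_error_le {δ : ℝ} (hn : 20 ≤ n) (hm : m ≤ n.choose 2) (hδ0 : 0 < δ)
    (hδ : δ ≤ edgeDensity n m) (hη : n * (1 - δ ^ 2 / 4) ^ (n / 8) ≤ 1)
    (hc : Real.exp (-4) * Real.exp (-(3000 / n)) ≥ Real.exp (-5)) :
    (orientedGnm n m).real (midClosed n 2) + slotProb (n.choose 2) m (2 * n - 3) ≤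
      3 * ((n : ℝ) ^ 6 * (1 - δ ^ 2 / 4) ^ (n / 8)) * slotProb (n.choose 2) m (n - 1) ∧
    (orientedGnm n m).real (atypical n) ≤
      (10 + 8 * Real.exp 5) * ((n : ℝ) ^ 6 * (1 - δ ^ 2 / 4) ^ (n / 8)) *
        slotProb (n.choose 2) m (2 * n - 3) := by
  have := isProbabilityMeasure_orientedGnm hm
  have hn' : (20 : ℝ) ≤ n := by exact_mod_cast hn
  have hp1 : edgeDensity n m ≤ 1 := div_le_one_of_le₀ (by exact_mod_cast hm) (by positivity)
  set p := edgeDensity n m with hp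
  set θ := 1 - δ ^ 2 / 4 with hθ
  have hθ0 : 0 ≤ θ := by nlinarith
  have hθ1 : θ ≤ 1 := by nlinarith
  have hxθ : 1 - p / 2 ≤ θ := by nlinarith
  -- Since 1-p = (1-p/2)^2 - p^2/4, missing both directions of a pair is strictly less likely than
  -- two independent missing arcs. This gap makes `lowDegree` negligible.
  have hpx : 1 - p ≤ θ * (1 - p / 2) ^ 2 := by
    have h1 : (1 - p / 2) ^ 2 ≤ 1 := by nlinarith
    have h2 : δ ^ 2 ≤ p ^ 2 := by nlinarith
    nlinarith [mul_nonneg (sq_nonneg δ) (by linarith : 0 ≤ 1 - (1 - p / 2) ^ 2)]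
  have hf1 := slotProb_pos hm (n - 1)
  have hf2 := slotProb_pos hm (2 * n - 3)
  have hNr : (n.choose 2 : ℝ) = n * (n - 1) / 2 := Nat.cast_choose_two ℝ n
  have h3n : 3 * n ≤ n.choose 2 := by
    have : (3 * n : ℝ) ≤ n.choose 2 := by rw [hNr]; nlinarith
    exact_mod_cast this
  have hθn : 0 ≤ θ ^ (n / 8) := by positivity
  have hnk : ∀ k ≤ 6, (n : ℝ) ^ k * θ ^ (n / 8) ≤ (n : ℝ) ^ 6 * θ ^ (n / 8) := by
    intro k hk
    exact mul_le_mul_of_nonneg_right (pow_le_pow_right₀ (by linarith) hk) hθn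
  have hpow : ∀ j, n / 8 ≤ j → θ ^ j ≤ θ ^ (n / 8) := fun j hj =>
    pow_le_pow_of_le_one hθ0 hθ1 hj
  have hxpow : ∀ j, n / 8 ≤ j → (1 - p / 2) ^ j ≤ θ ^ (n / 8) := fun j hj =>
    (pow_le_pow_left₀ (by linarith) hxθ j).trans (hpow j hj)
  have hη2 : (n + 1) * (n * θ ^ (n / 8)) ≤ 2 * ((n : ℝ) ^ 6 * θ ^ (n / 8)) := by
    have := hnk 2 (by norm_num)
    nlinarith [mul_nonneg (by linarith : (0 : ℝ) ≤ n * (n - 1)) hθn]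
  set η := (n : ℝ) ^ 6 * θ ^ (n / 8) with hηdef
  have hη1 : θ ^ (n / 8) ≤ η := by simpa using hnk 0 (by norm_num)
  have hmid : ∀ t K : ℕ, 1 ≤ t → 4 * K ≤ 3 * (t * (n - t)) →
      (orientedGnm n m).real (midClosed n t) ≤ 2 * η * slotProb (n.choose 2) m K := by
    intro t K ht hK
    refine (real_midClosed_le (K := K) (by omega) hm hθ0 hθ1 hxθ hη ht fun k h1 h2 =>
      hK.trans (Nat.mul_le_mul_left 3 (mul_sub_ge h1 h2))).trans ?_
    rw [← mul_assoc]
    exact mul_le_mul_of_nonneg_right hη2 (slotProb_pos hm K).le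
  constructor
  -- The condition 4K ≤ 3t(n-t) reads 4(n-1) ≤ 6(n-2) here; below, with t = 3, it reads 4(2n-3) ≤
  -- 9(n-3), true from n = 15 on.
  · have h1 := hmid 2 (n - 1) (by norm_num) (by omega)
    have h2 := slotProb_add_le (K := n - 1) hm (n - 2) (by omega)
    rw [show n - 1 + (n - 2) = 2 * n - 3 by omega] at h2
    change _ ≤ (1 - p / 2) ^ (n - 2) * _ at h2
    have h3 := mul_le_mul_of_nonneg_right ((hxpow (n - 2) (by omega)).trans hη1) hf1.le
    linarith
  · have h1 := hmid 3 (2 * n - 3) (by norm_num) (by omega)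
    have h2 : (orientedGnm n m).real (threeSmall n) ≤
        8 * η * slotProb (n.choose 2) m (2 * n - 3) := by
      refine (orientedGnm_real_threeSmall_le hm (by omega) h3n).trans ?_
      have h2 := slotProb_add_le (K := 2 * n - 3) hm (n - 15) (by omega)
      rw [show 2 * n - 3 + (n - 15) = 3 * (n - 6) by omega] at h2
      change _ ≤ (1 - p / 2) ^ (n - 15) * _ at h2
      have h3 := h2.trans (mul_le_mul_of_nonneg_right (hxpow (n - 15) (by omega)) hf2.le)
      have h4 := mul_le_mul_of_nonneg_left h3 (by positivity : 0 ≤ 8 * (n : ℝ) ^ 6)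
      refine h4.trans (le_of_eq ?_)
      rw [hηdef]; ring
    have h3 : (orientedGnm n m).real (lowDegree n) ≤
        8 * Real.exp 5 * η * slotProb (n.choose 2) m (2 * n - 3) := by
      have hx0 : 0 < 1 - p / 2 := by linarith
      have hg0 := tiltCoeff_nonneg (p := p) (hδ0.le.trans hδ) hp1
      have hg1 := tiltCoeff_le_one hp1
      have lo := (slotProb_choose_two_bounds (by omega) hm hp (by omega)
        (abs_two_mul_sub_four_le (by omega))).1
      have lo2 : (1 - p / 2) ^ (2 * n - 3) * Real.exp (-5) ≤
          slotProb (n.choose 2) m (2 * n - 3) := by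
        refine le_trans ?_ lo
        rw [mul_assoc]
        refine mul_le_mul_of_nonneg_left (hc.le.trans ?_) (by positivity)
        refine mul_le_mul_of_nonneg_right (Real.exp_le_exp.2 (by linarith)) (Real.exp_pos _).le
      -- The factor 8 compensates (1-p/2)^3 ≥ 1/8, as 2n-3 = 2(n-3) + 3.
      have h4 : (1 - p) ^ (n - 3) ≤ θ ^ (n / 8) * (8 * (1 - p / 2) ^ (2 * n - 3)) := by
        calc (1 - p) ^ (n - 3) ≤ (θ * (1 - p / 2) ^ 2) ^ (n - 3) :=
              pow_le_pow_left₀ (by linarith) hpx _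
          _ = θ ^ (n - 3) * (1 - p / 2) ^ (2 * (n - 3)) := by rw [mul_pow, ← pow_mul]
          _ ≤ θ ^ (n / 8) * (8 * (1 - p / 2) ^ (2 * n - 3)) := by
              refine mul_le_mul (hpow _ (by omega)) ?_ (by positivity) hθn
              rw [show 2 * n - 3 = 2 * (n - 3) + 3 by omega, pow_add]
              have h8 : (1 : ℝ) ≤ 8 * (1 - p / 2) ^ 3 := by
                have := pow_le_pow_left₀ (by norm_num) (by linarith : (1 / 2 : ℝ) ≤ 1 - p / 2) 3
                linarith
              nlinarith [pow_pos hx0 (2 * (n - 3))]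
      have h5 : (1 - p / 2) ^ (2 * n - 3) ≤ Real.exp 5 * slotProb (n.choose 2) m (2 * n - 3) := by
        have := mul_le_mul_of_nonneg_left lo2 (Real.exp_pos 5).le
        rwa [mul_left_comm, ← Real.exp_add, show (5 : ℝ) + -5 = 0 by norm_num, Real.exp_zero,
          mul_one] at this
      calc (orientedGnm n m).real (lowDegree n) ≤ n ^ 3 * (1 - p) ^ (n - 3) :=
            orientedGnm_real_lowDegree_le hm
        _ ≤ n ^ 3 * (θ ^ (n / 8) *
              (8 * (Real.exp 5 * slotProb (n.choose 2) m (2 * n - 3)))) := by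
            refine mul_le_mul_of_nonneg_left (h4.trans ?_) (by positivity)
            exact mul_le_mul_of_nonneg_left (by linarith) hθn
        _ = (n ^ 3 * θ ^ (n / 8)) * (8 * Real.exp 5 * slotProb (n.choose 2) m (2 * n - 3)) := by
            ring
        _ ≤ η * (8 * Real.exp 5 * slotProb (n.choose 2) m (2 * n - 3)) :=
            mul_le_mul_of_nonneg_right (hnk 3 (by norm_num)) (by positivity)
        _ = _ := by ring
    have h4 := measureReal_union_le (μ := orientedGnm n m) (midClosed n 3 ∪ lowDegree n)
      (threeSmall n)
    have h5 := measureReal_union_le (μ := orientedGnm n m) (midClosed n 3) (lowDegree n)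
    rw [atypical]
    linarith

end

/-! ### Vertex independence, limits and the final algebra. -/

lemma exists_perm_map_three {n : ℕ} {s a b s' a' b' : Fin n} (hsa : s ≠ a) (hsb : s ≠ b)
    (hab : a ≠ b) (hsa' : s' ≠ a') (hsb' : s' ≠ b') (hab' : a' ≠ b') :
    ∃ σ : Equiv.Perm (Fin n), σ s = s' ∧ σ a = a' ∧ σ b = b' := by
  have hinj : ∀ {x y z : Fin n}, x ≠ y → x ≠ z → y ≠ z → Function.Injective ![x, y, z] := by
    intro x y z h1 h2 h3 i j h
    fin_cases i <;> fin_cases j <;> simp_all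
  have := Equiv.Perm.isMultiplyPretransitive (Fin n) 3
  obtain ⟨σ, hσ⟩ := MulAction.exists_smul_eq (Equiv.Perm (Fin n))
    (⟨![s, a, b], hinj hsa hsb hab⟩ : Fin 3 ↪ Fin n) ⟨![s', a', b'], hinj hsa' hsb' hab'⟩
  have h := fun i => DFunLike.congr_fun hσ i
  exact ⟨σ, by simpa using h 0, by simpa using h 1, by simpa using h 2⟩

/-- The probabilities in question do not depend on the vertices. -/
lemma exists_common_real {n m : ℕ} (hm : m ≤ n.choose 2) :
    ∃ P₁ P₂ : ℝ, ∀ s a b : Fin n, s ≠ a → s ≠ b → a ≠ b →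
      (orientedGnm n m).real (notReach s a) = P₁ ∧ (orientedGnm n m).real (notReach b s) = P₁ ∧
      (orientedGnm n m).real (notReach s a ∩ notReach b s) = P₂ := by
  by_cases h : ∃ s a b : Fin n, s ≠ a ∧ s ≠ b ∧ a ≠ b
  · obtain ⟨s, a, b, hsa, hsb, hab⟩ := h
    refine ⟨(orientedGnm n m).real (notReach s a),
      (orientedGnm n m).real (notReach s a ∩ notReach b s),
      fun s' a' b' hsa' hsb' hab' => ⟨?_, ?_, ?_⟩⟩
    · obtain ⟨σ, h1, h2, -⟩ := exists_perm_map_three hsa hsb hab hsa' hsb' hab'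
      rw [← orientedGnm_real_relabel hm σ (notReach s a)]
      simp_rw [notReach_relabel, h1, h2]
      rfl
    -- The permutation sends (s, a, b) to (b', s', a'), so the second event has the same probability
    -- as the first.
    · obtain ⟨σ, h1, h2, -⟩ := exists_perm_map_three hsa hsb hab hsb'.symm hab'.symm hsa'
      rw [← orientedGnm_real_relabel hm σ (notReach s a)]
      simp_rw [notReach_relabel, h1, h2]
      rfl
    · obtain ⟨σ, h1, h2, h3⟩ := exists_perm_map_three hsa hsb hab hsa' hsb' hab'
      rw [← orientedGnm_real_relabel hm σ (notReach s a ∩ notReach b s)]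
      simp_rw [Set.mem_inter_iff, notReach_relabel, h1, h2, h3]
      rfl
  · push Not at h
    exact ⟨0, 0, fun s a b h1 h2 h3 => absurd (h s a b h1 h2) h3⟩

/-- Combines P = c f (1 + O(η)) with f = Y e^(O(1/n)). -/
lemma tendsto_div_one {P f Y η : ℕ → ℝ} {c C B : ℝ} (hc : 0 < c)
    (hη : Tendsto η atTop (𝓝 0)) (hY : ∀ᶠ n in atTop, 0 < Y n)
    (hf : ∀ᶠ n : ℕ in atTop, Y n * Real.exp (-(B / n)) ≤ f n ∧ f n ≤ Y n * Real.exp (B / n))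
    (hP : ∀ᶠ n in atTop, |P n - c * f n| ≤ C * η n * f n) :
    Tendsto (fun n => P n / (c * Y n)) atTop (𝓝 1) := by
  have hB : Tendsto (fun n : ℕ => B / (n : ℝ)) atTop (𝓝 0) := tendsto_const_div_atTop_nhds_zero_nat B
  have hu : Tendsto (fun n : ℕ => Real.exp (B / (n : ℝ))) atTop (𝓝 1) := by
    simpa [Function.comp_def] using (Real.continuous_exp.tendsto 0).comp hB
  have hl : Tendsto (fun n : ℕ => Real.exp (-(B / (n : ℝ)))) atTop (𝓝 1) := by
    simpa [Function.comp_def] using (Real.continuous_exp.tendsto _).comp hB.neg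
  have hfY : Tendsto (fun n => f n / Y n) atTop (𝓝 1) := by
    refine tendsto_of_tendsto_of_tendsto_of_le_of_le' hl hu ?_ ?_
    · filter_upwards [hf, hY] with n h1 h2
      rw [le_div_iff₀ h2, mul_comm]
      exact h1.1
    · filter_upwards [hf, hY] with n h1 h2
      rw [div_le_iff₀ h2, mul_comm]
      exact h1.2
  have hdiff : Tendsto (fun n => P n / (c * Y n) - f n / Y n) atTop (𝓝 0) := by
    have h0 : Tendsto (fun n => C / c * η n * (f n / Y n)) atTop (𝓝 0) := by
      simpa using (hη.const_mul (C / c)).mul hfY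
    refine squeeze_zero_norm' ?_ h0
    filter_upwards [hP, hY] with n h1 h2
    have e1 : P n / (c * Y n) - f n / Y n = (P n - c * f n) / (c * Y n) := by
      field_simp
    have e2 : C / c * η n * (f n / Y n) = C * η n * f n / (c * Y n) := by
      field_simp
    rw [Real.norm_eq_abs, e1, e2, abs_div, abs_of_pos (mul_pos hc h2)]
    gcongr
  simpa using hfY.add hdiff

theorem theorem2p3 (m : ℕ → ℕ)
    (hle : ∀ᶠ n in atTop, m n ≤ n.choose 2)
    (hm : Tendsto m atTop atTop)
    (p : ℕ → ℝ) (hp : ∀ n, p n = edgeDensity n (m n))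
    (hliminf : 0 < liminf p atTop) :
    (∃ ε : ℕ → ℝ, Tendsto ε atTop (𝓝 0) ∧
      ∀ᶠ n in atTop, ∀ s a b : Fin n, s ≠ a → s ≠ b → a ≠ b →
        eventCov (orientedGnm n (m n)) (notReach s a) (notReach b s) =
          (3 / (4 - 2 * p n) * Real.exp (-(2 * p n * (1 - p n) / (2 - p n) ^ 2)) - 1 + ε n) *
            (orientedGnm n (m n)).real (notReach s a) ^ 2) ∧
    (∃ δ : ℕ → ℝ, Tendsto δ atTop (𝓝 0) ∧
      ∀ᶠ n in atTop, ∀ s a b : Fin n, s ≠ a → s ≠ b → a ≠ b →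
        eventCov (orientedGnm n (m n)) (notReach s a) (notReach b s) =
          (3 * Real.exp (-(2 * p n * (1 - p n) / (2 - p n) ^ 2)) - 4 + 2 * p n + δ n) *
            (1 - p n / 2) ^ (2 * n - 3) *
              Real.exp (-(2 * p n * (1 - p n) / (2 - p n) ^ 2))) := by
  classical
  set δ : ℝ := liminf p atTop / 2 with hδdef
  have hδ0 : 0 < δ := by positivity
  have hpge : ∀ᶠ n in atTop, δ ≤ p n := by
    have hb : IsBoundedUnder (· ≥ ·) atTop p := by
      refine isBoundedUnder_of ⟨0, fun n => ?_⟩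
      rw [hp, edgeDensity]
      positivity
    filter_upwards [eventually_lt_of_lt_liminf (show δ < liminf p atTop by linarith) hb] with n hn
    exact hn.le
  have hple : ∀ᶠ n in atTop, p n ≤ 1 := by
    filter_upwards [hle] with n hn
    rw [hp]
    exact div_le_one_of_le₀ (by exact_mod_cast hn) (by positivity)
  have hδ1 : δ ≤ 1 := by
    obtain ⟨n, h1, h2⟩ := (hpge.and hple).exists
    exact h1.trans h2
  set θ : ℝ := 1 - δ ^ 2 / 4 with hθdef
  have hθ0 : 0 ≤ θ := by nlinarith
  have hθ1 : θ < 1 := by nlinarith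
  have hη := tendsto_pow_mul_pow_div hθ0 hθ1 6 8 (by norm_num)
  have hη1 : ∀ᶠ n : ℕ in atTop, n * θ ^ (n / 8) ≤ 1 := by
    have := tendsto_pow_mul_pow_div hθ0 hθ1 1 8 (by norm_num)
    filter_upwards [this.eventually_le_const (by norm_num : (0 : ℝ) < 1)] with n hn
    simpa using hn
  have hc : ∀ᶠ n : ℕ in atTop, Real.exp (-4) * Real.exp (-(3000 / (n : ℝ))) ≥ Real.exp (-5) := by
    filter_upwards [eventually_ge_atTop 3000] with n hn
    have hn' : (3000 : ℝ) ≤ n := by exact_mod_cast hn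
    rw [← Real.exp_add]
    apply Real.exp_le_exp.2
    have : 3000 / (n : ℝ) ≤ 1 := div_le_one_of_le₀ hn' (by linarith)
    linarith
  -- Values common to all triples make the error sequences independent of the chosen vertices.
  have hcommon : ∀ n, ∃ P₁ P₂ : ℝ, m n ≤ n.choose 2 → ∀ s a b : Fin n, s ≠ a → s ≠ b → a ≠ b →
      (orientedGnm n (m n)).real (notReach s a) = P₁ ∧
      (orientedGnm n (m n)).real (notReach b s) = P₁ ∧
      (orientedGnm n (m n)).real (notReach s a ∩ notReach b s) = P₂ := by
    intro n
    by_cases h : m n ≤ n.choose 2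
    · obtain ⟨P₁, P₂, hP⟩ := exists_common_real h
      exact ⟨P₁, P₂, fun _ => hP⟩
    · exact ⟨0, 0, fun h' => absurd h' h⟩
  choose P₁ P₂ hP using hcommon
  have hevent : ∀ᶠ n in atTop, 20 ≤ n ∧ m n ≤ n.choose 2 ∧ δ ≤ p n ∧ p n ≤ 1 ∧
      n * θ ^ (n / 8) ≤ 1 ∧ Real.exp (-4) * Real.exp (-(3000 / (n : ℝ))) ≥ Real.exp (-5) := by
    filter_upwards [eventually_ge_atTop 20, hle, hpge, hple, hη1, hc] with n h1 h2 h3 h4 h5 h6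
    exact ⟨h1, h2, h3, h4, h5, h6⟩
  -- `u` and `v` are the ratios of the true probabilities to their predicted main terms; both tend
  -- to 1.
  set u : ℕ → ℝ := fun n =>
    P₁ n / (2 * ((1 - p n / 2) ^ (n - 1) * Real.exp (-(1 * tiltCoeff (p n))))) with hu
  set v : ℕ → ℝ := fun n =>
    P₂ n / (3 * ((1 - p n / 2) ^ (2 * n - 3) * Real.exp (-(4 * tiltCoeff (p n))))) with hv
  have hu1 : Tendsto u atTop (𝓝 1) := by
    refine tendsto_div_one (f := fun n => slotProb (n.choose 2) (m n) (n - 1)) (C := 3) (B := 3000)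
      (by norm_num) hη ?_ ?_ ?_
    · filter_upwards [hple] with n hn
      have : 0 < 1 - p n / 2 := by linarith
      positivity
    · filter_upwards [hevent] with n ⟨h1, h2, _⟩
      exact slotProb_choose_two_bounds (by omega) h2 (hp n) (by omega)
        (abs_pred_sub_one_le (by omega))
    · filter_upwards [hevent] with n ⟨h1, h2, h3, h4, h5, h6⟩
      have h := hP n h2 ⟨0, by omega⟩ ⟨1, by omega⟩ ⟨2, by omega⟩ (by simp) (by simp) (by simp)
      rw [← h.1]
      exact (abs_real_notReach_sub_le h2 (by simp)).trans
        (real_error_le h1 h2 hδ0 (hp n ▸ h3) h5 h6).1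
  have hv1 : Tendsto v atTop (𝓝 1) := by
    refine tendsto_div_one (f := fun n => slotProb (n.choose 2) (m n) (2 * n - 3))
      (C := 3 * (10 + 8 * Real.exp 5)) (B := 3000) (by norm_num) hη ?_ ?_ ?_
    · filter_upwards [hple] with n hn
      have : 0 < 1 - p n / 2 := by linarith
      positivity
    · filter_upwards [hevent] with n ⟨h1, h2, _⟩
      exact slotProb_choose_two_bounds (by omega) h2 (hp n) (by omega)
        (abs_two_mul_sub_four_le (by omega))
    · filter_upwards [hevent] with n ⟨h1, h2, h3, h4, h5, h6⟩
      have h := hP n h2 ⟨0, by omega⟩ ⟨1, by omega⟩ ⟨2, by omega⟩ (by simp) (by simp) (by simp)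
      rw [← h.2.2]
      refine (abs_real_notReach_inter_sub_le h2 (by simp) (by simp) (by simp)).trans ?_
      have := (real_error_le h1 h2 hδ0 (hp n ▸ h3) h5 h6).2
      linarith
  have hu0 : ∀ᶠ n in atTop, u n ≠ 0 := hu1.eventually_ne one_ne_zero
  have hexp : ∀ n, Real.exp (-(2 * p n * (1 - p n) / (2 - p n) ^ 2)) =
      Real.exp (-tiltCoeff (p n)) ^ 2 := by
    intro n
    rw [← Real.exp_nat_mul, tiltCoeff]
    congr 1
    push_cast
    ring
  have hE1 : ∀ᶠ n in atTop, Real.exp (-tiltCoeff (p n)) ^ 2 ≤ 1 := by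
    filter_upwards [hpge, hple] with n h1 h2
    refine pow_le_one₀ (Real.exp_pos _).le (Real.exp_le_one_iff.2 ?_)
    have := tiltCoeff_nonneg (hδ0.le.trans h1) h2
    linarith
  -- Factoring through (1-p/2)^(n-2) exposes the common factor (1-p/2)^(2n-4) of P₁^2 and P₂.
  have hP₁ : ∀ᶠ n in atTop, P₁ n =
      2 * ((1 - p n / 2) ^ (n - 2) * (1 - p n / 2) * Real.exp (-tiltCoeff (p n))) * u n := by
    filter_upwards [hevent] with n ⟨h1, _, _, h4, _⟩
    have hx : 0 < 1 - p n / 2 := by linarith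
    rw [← pow_succ, show n - 2 + 1 = n - 1 by omega]
    simp only [hu, one_mul]
    rw [mul_div_cancel₀ _ (by positivity)]
  have hP₂ : ∀ᶠ n in atTop, P₂ n = 3 * (((1 - p n / 2) ^ (n - 2)) ^ 2 * (1 - p n / 2) *
      Real.exp (-tiltCoeff (p n)) ^ 4) * v n := by
    filter_upwards [hevent] with n ⟨h1, _, _, h4, _⟩
    have hx : 0 < 1 - p n / 2 := by linarith
    rw [← pow_mul, ← pow_succ, show (n - 2) * 2 + 1 = 2 * n - 3 by omega, ← Real.exp_nat_mul]
    simp only [hv]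
    rw [show ((4 : ℕ) : ℝ) * -tiltCoeff (p n) = -(4 * tiltCoeff (p n)) by push_cast; ring,
      mul_div_cancel₀ _ (by positivity)]
  have hcov : ∀ᶠ n in atTop, ∀ s a b : Fin n, s ≠ a → s ≠ b → a ≠ b →
      eventCov (orientedGnm n (m n)) (notReach s a) (notReach b s) = P₂ n - P₁ n ^ 2 ∧
        (orientedGnm n (m n)).real (notReach s a) = P₁ n := by
    filter_upwards [hle] with n hn s a b hsa hsb hab
    obtain ⟨h1, h2, h3⟩ := hP n hn s a b hsa hsb hab
    refine ⟨?_, h1⟩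
    rw [eventCov, h1, h2, h3, sq]
  simp_rw [hexp]
  constructor
  -- With E = e^(-g), the quotient P₂/P₁^2 is exactly 3/(4-2p) E^2 v/u^2, so this is the deviation
  -- from its value at u = v = 1.
  · refine ⟨fun n => 3 / (4 - 2 * p n) * Real.exp (-tiltCoeff (p n)) ^ 2 * (v n / u n ^ 2 - 1),
      ?_, ?_⟩
    · have h0 : Tendsto (fun n => 3 / 2 * ‖v n / u n ^ 2 - 1‖) atTop (𝓝 0) := by
        have h1 : Tendsto (fun n => v n / u n ^ 2 - 1) atTop (𝓝 0) := by
          simpa using (hv1.div (hu1.pow 2) (by norm_num)).sub_const 1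
        simpa using h1.norm.const_mul (3 / 2)
      refine squeeze_zero_norm' ?_ h0
      filter_upwards [hple, hE1] with n h1 h2
      rw [norm_mul]
      refine mul_le_mul_of_nonneg_right ?_ (norm_nonneg _)
      have h3 : 3 / (4 - 2 * p n) ≤ 3 / 2 := by
        gcongr
        linarith
      have h4 : 0 ≤ 3 / (4 - 2 * p n) := div_nonneg (by norm_num) (by linarith)
      rw [Real.norm_of_nonneg (by positivity)]
      calc _ ≤ 3 / 2 * 1 := mul_le_mul h3 h2 (by positivity) (by norm_num)
        _ = _ := by norm_num
    · filter_upwards [hcov, hP₁, hP₂, hu0, hple] with n h1 h2 h3 h4 h5 s a b hsa hsb hab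
      obtain ⟨e1, e2⟩ := h1 s a b hsa hsb hab
      have hx : 2 - p n ≠ 0 := by linarith
      rw [e1, e2, h2, h3, show 4 - 2 * p n = 2 * (2 - p n) by ring]
      field_simp
      ring
  -- Dividing P₂ - P₁^2 by (1-p/2)^(2n-3) E^2 leaves 3E^2 v - 4(1-p/2) u^2, where 4(1-p/2) = 4-2p.
  · refine ⟨fun n => 3 * Real.exp (-tiltCoeff (p n)) ^ 2 * (v n - 1) -
      4 * (1 - p n / 2) * (u n ^ 2 - 1), ?_, ?_⟩
    · have h0 : Tendsto (fun n => 3 * ‖v n - 1‖ + 4 * ‖u n ^ 2 - 1‖) atTop (𝓝 0) := by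
        have h1 : Tendsto (fun n => v n - 1) atTop (𝓝 0) := by simpa using hv1.sub_const 1
        have h2 : Tendsto (fun n => u n ^ 2 - 1) atTop (𝓝 0) := by
          simpa using (hu1.pow 2).sub_const 1
        simpa using (h1.norm.const_mul 3).add (h2.norm.const_mul 4)
      refine squeeze_zero_norm' ?_ h0
      filter_upwards [hpge, hple, hE1] with n h1 h2 h3
      refine (norm_sub_le _ _).trans (add_le_add ?_ ?_)
      · rw [norm_mul, Real.norm_of_nonneg (by positivity)]
        exact mul_le_mul_of_nonneg_right (by linarith) (norm_nonneg _)
      · rw [norm_mul, Real.norm_of_nonneg (by linarith)]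
        exact mul_le_mul_of_nonneg_right (by linarith) (norm_nonneg _)
    · filter_upwards [hcov, hP₁, hP₂, eventually_ge_atTop 2] with n h1 h2 h3 h4 s a b hsa hsb hab
      obtain ⟨e1, -⟩ := h1 s a b hsa hsb hab
      rw [e1, h2, h3, show 2 * n - 3 = (n - 2) * 2 + 1 by omega, pow_succ _ ((n - 2) * 2), pow_mul]
      ring
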